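/- Let $G$ be a finite polygon decomposition of a connected closed oriented surface of genus $g\ge 0$, with vertex set $\mathcal G_0$, edge set $\mathcal G_1\neq\emptyset$ and face set $\mathcal G_2$, such that every edge lies between two different vertices and is shared by two different faces; the edges carry fixed orientations and the faces inherit that of the surface. ($G$ is described combinatorially by the cyclic orders of the directed edges around the faces; $g$ is given by $|\mathcal G_0|-|\mathcal G_1|+|\mathcal G_2|=2-2g$.) Let $G^*$ be the dual decomposition, the dual edge $e^*$ crossing $e$ from right to left. For $d\ge 1$ let $\mathbb Z_d=\mathbb Z/d\mathbb Z$, let $H_1(G;\mathbb Z_d)$ be the group of $1$-cycles modulo $1$-boundaries of the cellular chain complex of $G$, and let $H^1(G;\mathbb Z_d):=H_1(G^*;\mathbb Z_d)$; the $1$-cycles of $G^*$ are called cocycles. Let $b_1(G;\mathbb Z_d)$ be the smallest number of generators of $H_1(G;\mathbb Z_d)$. Let $\mathcal H_G=\bigotimes_{e\in\mathcal G_1}\mathbb C^d$, let $\omega=e^{2\pi \mathrm i/d}$, and let $X_e,Z_e$ be the unitaries that act on the factor $e$ by $Xl_i=l_{i+1}$ (indices mod $d$), $Zl_i=\omega^i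 l_i$ in the standard basis $l_0,\dots,l_{d-1}$. For a $1$-chain $\gamma=\sum_e c_e e$ and a $1$-cochain $\gamma^*=\sum_e c^*_e e^*$ over $\mathbb Z_d$ put $Z_\gamma=\prod_e Z_e^{c_e}$ and $X_{\gamma^*}=\prod_e X_e^{c^*_e}$. Let $a_v$ be the product of $X_e$ over the edges coming into $v$ and of $X_e^{-1}$ over the edges going out of $v$, let $b_f$ be the product of $Z_e^{\pm1}$ over the edges of $f$, with the sign telling whether the orientation of $e$ agrees with that of $f$, and put $A_v=\frac1d\sum_{j=0}^{d-1}a_v^j$, $B_f=\frac1d\sum_{j=0}^{d-1}b_f^j$. Let $\mathcal S_G$ be the ground state space (the eigenspace of the lowest eigenvalue) of $H_G=-\sum_{v}A_v-\sum_{f}B_f$, and let $\mathcal A(\mathcal S_G)$ be the algebra of the restrictions to $\mathcal S_G$ of the linear operators $O$ on $\mathcal H_G$ with $O\mathcal S_G\subset\mathcal S_G$. Then: (i) $\pi([\gamma])=Z_\gamma\upharpoonright\mathcal S_G$ ($\gamma$ a cycle) and $\pi^*([\gamma^*])=X_{\gamma^*}\upharpoonright\mathcal S_G$ ($\gamma^*$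 a cocycle) are well defined unitary representations of $H_1(G;\mathbb Z_d)$ and of $H^1(G;\mathbb Z_d)$ on $\mathcal S_G$. (ii) There is an isomorphism $\Phi:\mathbb Z_d^g\oplus\mathbb Z_d^g\to H_1(G;\mathbb Z_d)$. For isomorphisms $\Phi:\mathbb Z_d^g\oplus\mathbb Z_d^g\to H_1(G;\mathbb Z_d)$ and $\Phi^*:\mathbb Z_d^g\oplus\mathbb Z_d^g\to H^1(G;\mathbb Z_d)$ write $Z_{\alpha,\beta}=\pi(\Phi(\alpha,\beta))$ and $X_{\alpha,\beta}=\pi^*(\Phi^*(\alpha,\beta))$, and let $v_1,\dots,v_g$ be the standard generators of $\mathbb Z_d^g$. For all $\Phi,\Phi^*$ the algebra $\mathcal A(\mathcal S_G)$ is generated by the $4g$ operators $X_{v_i,0},X_{0,v_i},Z_{v_i,0},Z_{0,v_i}$, $1\le i\le g$, and $(X_{\alpha,\beta})^d=\mathbb I=(Z_{\alpha,\beta})^d$ for all $\alpha,\beta$. For every $\Phi$ there is exactly one $\Phi^*$ such that, with $[[A,B]]=ABA^{-1}B^{-1}$, one has $[[Z_{v_i,0},X_{0,v_i}]]=\omega\mathbb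 I=[[Z_{0,v_i},X_{v_i,0}]]$ for all $i$, while all other pairs of these generators commute. Moreover $\mathcal A(\mathcal S_G)\cong\bigotimes_{i=1}^{2g}\mathcal M_d(\mathbb C)$ as algebras. (iii) $\dim\mathcal S_G=d^{\,b_1(G;\mathbb Z_d)}=d^{2g}$. (iv) For every $\Psi\in\mathcal S_G$ with $\Psi\ne0$, $\mathcal S_G=\mathrm{span}\{X_{\tau^*}Z_\tau\Psi:\tau^*\text{ a cocycle},\ \tau\text{ a cycle}\}$. -/

import Mathlib

noncomputable section

namespace KitaevModel

/-- A dart is an edge together with a direction of travel: `(e, true)` follows the fixed orientation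
of the edge `e`, `(e, false)` runs against it. This map reverses the direction. -/
def reverse (E : Type*) : Equiv.Perm (E × Bool) :=
  (Equiv.refl E).prodCongr Equiv.boolNot

/-- A polygon decomposition, with edge set `E`, of a connected closed oriented surface, given as a
combinatorial map: the surface is glued from polygons, `faceNext x` being the dart that follows the
dart `x` on the boundary of the face to the left of `x`, and the side `x` of a polygon being glued to
the side `reverse x`. If `x` starts at the vertex `v`, then so does `faceNext (reverse x)`, and it is
the neighbour of `x` in the rotation about `v`. -/
structure PolygonDecomposition (E : Type*) where
  faceNext : Equiv.Perm (E × Bool)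
  /-- The surface is connected. -/
  connected : ∀ x y : E × Bool,
    ∃ p ∈ Subgroup.closure ({faceNext, reverse E} : Set (Equiv.Perm (E × Bool))), p x = y
  /-- Every edge lies between two different vertices. -/
  endpoints_ne : ∀ e : E, ¬ (faceNext * reverse E).SameCycle (e, true) (e, false)
  /-- Every edge is shared by two different faces. -/
  faces_ne : ∀ e : E, ¬ faceNext.SameCycle (e, true) (e, false)

namespace PolygonDecomposition

variable {E : Type*} (G : PolygonDecomposition E)

/-- Rotation about the initial vertex of a dart. -/
def vertexNext : Equiv.Perm (E × Bool) := G.faceNext * reverse E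

/-- Vertices: the cycles of the rotation (sets of darts with a common initial vertex). -/
def Vertex : Type _ := Quotient (Equiv.Perm.SameCycle.setoid G.vertexNext)

/-- Faces: the cycles of `faceNext` (sets of darts that have the face on their left). -/
def Face : Type _ := Quotient (Equiv.Perm.SameCycle.setoid G.faceNext)

def origin (x : E × Bool) : G.Vertex := Quotient.mk _ x

def leftFace (x : E × Bool) : G.Face := Quotient.mk _ x

/-- The edge `e` is oriented from `tail e` to `head e`. -/
def tail (e : E) : G.Vertex := G.origin (e, true)

def head (e : E) : G.Vertex := G.origin (e, false)

/-- The face on whose boundary `e` runs in the positive direction. -/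
def left (e : E) : G.Face := G.leftFace (e, true)

/-- The face on whose boundary `e` runs in the negative direction. -/
def right (e : E) : G.Face := G.leftFace (e, false)

instance [Finite E] : Finite G.Vertex := inferInstanceAs (Finite (Quotient _))

instance [Finite E] : Finite G.Face := inferInstanceAs (Finite (Quotient _))

instance [Finite E] : Fintype G.Vertex := Fintype.ofFinite _

instance [Finite E] : Fintype G.Face := Fintype.ofFinite _

instance : DecidableEq G.Vertex := Classical.decEq _

instance : DecidableEq G.Face := Classical.decEq _

/-- The surface has genus `g`: its Euler characteristic is `2 - 2g`. -/
def HasGenus [Fintype E] (g : ℕ) : Prop :=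
  (Fintype.card G.Vertex : ℤ) - Fintype.card E + Fintype.card G.Face = 2 - 2 * g

lemma reverse_inv : (reverse E)⁻¹ = reverse E := by
  rw [inv_eq_iff_mul_eq_one]
  ext ⟨e, b⟩ <;> simp [reverse]

/-- The dual decomposition. The dual dart of `x` crosses `x` from right to left; its initial vertex
is the face to the right of `x`, the face to its left is the initial vertex of `x`, and the darts
along that dual face are obtained by rotating `x` counterclockwise about its initial vertex. In
particular the dual edge of `e` crosses `e` from right to left. -/
def dual : PolygonDecomposition E where
  faceNext := G.vertexNext⁻¹
  connected := by
    intro x y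
    obtain ⟨p, hp, hxy⟩ := G.connected x y
    refine ⟨p, ?_, hxy⟩
    refine (Subgroup.closure_le _).2 ?_ hp
    rintro q (rfl | rfl)
    · have h1 : G.vertexNext⁻¹ ∈ Subgroup.closure
          ({G.vertexNext⁻¹, reverse E} : Set (Equiv.Perm (E × Bool))) :=
        Subgroup.subset_closure (by simp)
      have h2 : reverse E ∈ Subgroup.closure
          ({G.vertexNext⁻¹, reverse E} : Set (Equiv.Perm (E × Bool))) :=
        Subgroup.subset_closure (by simp)
      have h3 := mul_mem (inv_mem h1) (inv_mem h2)
      simpa [vertexNext] using h3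
    · exact Subgroup.subset_closure (by simp)
  endpoints_ne := by
    intro e h
    apply G.faces_ne e
    have h4 : G.vertexNext⁻¹ * reverse E = reverse E * G.faceNext⁻¹ * (reverse E)⁻¹ := by
      simp [vertexNext, mul_inv_rev, reverse_inv]
    rw [h4, Equiv.Perm.sameCycle_conj, reverse_inv, Equiv.Perm.sameCycle_inv] at h
    simpa [reverse] using h.symm
  faces_ne := by
    intro e h
    exact G.endpoints_ne e (Equiv.Perm.sameCycle_inv.1 h)

section Homology

variable [Fintype E] (d : ℕ)

/-- The boundary map on `1`-chains, `∂ e = head e - tail e`. -/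
def boundary₁ : (E → ZMod d) →ₗ[ZMod d] (G.Vertex → ZMod d) :=
  Fintype.linearCombination (ZMod d) fun e =>
    Pi.single (G.head e) (1 : ZMod d) - Pi.single (G.tail e) 1

/-- The boundary map on `2`-chains: in `∂ f` an edge of `f` has coefficient `1` or `-1` according as
its orientation agrees with that of `f` or not. -/
def boundary₂ : (G.Face → ZMod d) →ₗ[ZMod d] (E → ZMod d) :=
  Fintype.linearCombination (ZMod d) fun f e =>
    (if G.left e = f then (1 : ZMod d) else 0) - (if G.right e = f then 1 else 0)

/-- The group of `1`-cycles. -/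
def cycles : Submodule (ZMod d) (E → ZMod d) := LinearMap.ker (G.boundary₁ d)

/-- The group of `1`-boundaries. -/
def boundaries : Submodule (ZMod d) (E → ZMod d) := LinearMap.range (G.boundary₂ d)

/-- The first homology group with coefficients in `ℤ/d`. -/
abbrev H₁ : Type _ := G.cycles d ⧸ (G.boundaries d).submoduleOf (G.cycles d)

/-- The homology class of a cycle. -/
def homologyClass (γ : G.cycles d) : G.H₁ d := Submodule.Quotient.mk γ

instance [NeZero d] : AddGroup.FG (G.H₁ d) :=
  haveI : Finite (G.H₁ d) := Quotient.finite _
  AddGroup.fg_of_finite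

/-- The first Betti number: the smallest number of generators of the first homology group. -/
def betti₁ [NeZero d] : ℕ := AddGroup.rank (G.H₁ d)

end Homology

end PolygonDecomposition

/-- `ω = exp (2πi/d)`. -/
def omega (d : ℕ) : ℂ := Complex.exp (2 * Real.pi * Complex.I / d)

lemma norm_omega (d : ℕ) : ‖omega d‖ = 1 := by
  have : (2 * Real.pi * Complex.I / d : ℂ) = ((2 * Real.pi / d : ℝ) : ℂ) * Complex.I := by
    push_cast; ring
  rw [omega, this, Complex.norm_exp_ofReal_mul_I]

/-- Multiplication by a complex number of modulus one. -/
def phase (z : ℂ) (hz : ‖z‖ = 1) : ℂ ≃ₗᵢ[ℂ] ℂ where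
  toLinearEquiv := LinearEquiv.smulOfNeZero ℂ ℂ z (by rintro rfl; simp at hz)
  norm_map' x := by simp [hz]

/-- The Hilbert space `⨂_{e ∈ E} ℂ^d`, written in its product orthonormal basis
`|k⟩ = ⨂_e l_{k e}`, `k : E → ℤ/d`. -/
abbrev Hilb (E : Type*) (d : ℕ) : Type _ := EuclideanSpace ℂ (E → ZMod d)

section Operators

variable {E : Type*} [Fintype E] [DecidableEq E] {d : ℕ} [NeZero d]

/-- The operator `X` at the edge `e`: it sends the basis vector `|k⟩` to `|k + δ_e⟩`. -/
def siteX (e : E) : Hilb E d ≃ₗᵢ[ℂ] Hilb E d :=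
  LinearIsometryEquiv.piLpCongrLeft 2 ℂ ℂ (Equiv.addRight (Pi.single e (1 : ZMod d)))

/-- The operator `Z` at the edge `e`: it multiplies the basis vector `|k⟩` by `ω ^ (k e)`. -/
def siteZ (e : E) : Hilb E d ≃ₗᵢ[ℂ] Hilb E d :=
  LinearIsometryEquiv.piLpCongrRight 2 fun k =>
    phase (omega d ^ (k e).val) (by rw [norm_pow, norm_omega, one_pow])

lemma siteX_commute (e e' : E) : Commute (siteX e : Hilb E d ≃ₗᵢ[ℂ] Hilb E d) (siteX e') := by
  ext ψ k
  simp [siteX, LinearIsometryEquiv.piLpCongrLeft_apply, Equiv.piCongrLeft', sub_right_comm,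
    ← sub_eq_add_neg]

lemma siteZ_commute (e e' : E) : Commute (siteZ e : Hilb E d ≃ₗᵢ[ℂ] Hilb E d) (siteZ e') := by
  ext ψ k
  simp [siteZ, phase, mul_left_comm]

/-- `∏_e X_e ^ (n e)`. -/
def prodX (n : E → ℤ) : Hilb E d ≃ₗᵢ[ℂ] Hilb E d :=
  Finset.univ.noncommProd (fun e => siteX e ^ n e) fun e _ e' _ _ =>
    (siteX_commute e e').zpow_zpow _ _

/-- `∏_e Z_e ^ (n e)`. -/
def prodZ (n : E → ℤ) : Hilb E d ≃ₗᵢ[ℂ] Hilb E d :=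
  Finset.univ.noncommProd (fun e => siteZ e ^ n e) fun e _ e' _ _ =>
    (siteZ_commute e e').zpow_zpow _ _

/-- The string operator `X_γ = ∏_e X_e ^ (γ e)` of a `1`-cochain `γ` (a `1`-chain of the dual). -/
def stringX (γ : E → ZMod d) : Hilb E d ≃ₗᵢ[ℂ] Hilb E d := prodX fun e => ((γ e).val : ℤ)

/-- The string operator `Z_γ = ∏_e Z_e ^ (γ e)` of a `1`-chain `γ`. -/
def stringZ (γ : E → ZMod d) : Hilb E d ≃ₗᵢ[ℂ] Hilb E d := prodZ fun e => ((γ e).val : ℤ)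

/-- A unitary regarded as an element of the algebra of linear operators. -/
abbrev toEnd {K : Type*} [SeminormedAddCommGroup K] [Module ℂ K] (U : K ≃ₗᵢ[ℂ] K) :
    Module.End ℂ K := U.toLinearEquiv.toLinearMap

/-- The algebra `{O : O K ⊆ K}` of operators that leave the subspace `K` invariant. -/
def preserving {H : Type*} [AddCommGroup H] [Module ℂ H] (K : Submodule ℂ H) :
    Subalgebra ℂ (Module.End ℂ H) where
  carrier := {O | ∀ ψ ∈ K, O ψ ∈ K}
  mul_mem' ha hb ψ hψ := ha _ (hb ψ hψ)
  add_mem' ha hb ψ hψ := K.add_mem (ha ψ hψ) (hb ψ hψ)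
  algebraMap_mem' c _ hψ := K.smul_mem c hψ

/-- Restriction to `K` of the operators that leave `K` invariant. -/
def restrictHom {H : Type*} [AddCommGroup H] [Module ℂ H] (K : Submodule ℂ H) :
    preserving K →ₐ[ℂ] Module.End ℂ K where
  toFun O := O.1.restrict O.2
  map_one' := rfl
  map_mul' _ _ := rfl
  map_zero' := rfl
  map_add' _ _ := rfl
  commutes' _ := rfl

/-- The algebra `A(K)` of the operators `O` with `O K ⊆ K`, acting on `K`. -/
def algebraOn {H : Type*} [AddCommGroup H] [Module ℂ H] (K : Submodule ℂ H) :
    Subalgebra ℂ (Module.End ℂ K) := (restrictHom K).range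

namespace PolygonDecomposition

variable (G : PolygonDecomposition E)

/-- `a_v`: the product of `X_e` over the edges coming into `v` and of `X_e⁻¹` over the edges going
out of `v`. -/
def vertexUnitary (v : G.Vertex) : Hilb E d ≃ₗᵢ[ℂ] Hilb E d :=
  prodX fun e => (if G.head e = v then 1 else 0) - (if G.tail e = v then 1 else 0)

/-- `b_f`: the product of `Z_e` over the positively oriented edges of `f` and of `Z_e⁻¹` over the
negatively oriented ones. -/
def faceUnitary (f : G.Face) : Hilb E d ≃ₗᵢ[ℂ] Hilb E d :=
  prodZ fun e => (if G.left e = f then 1 else 0) - (if G.right e = f then 1 else 0)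

/-- `A_v = d⁻¹ ∑_{j < d} (a_v)^j`. -/
def vertexOperator (v : G.Vertex) : Module.End ℂ (Hilb E d) :=
  (d : ℂ)⁻¹ • ∑ j ∈ Finset.range d, toEnd (G.vertexUnitary v) ^ j

/-- `B_f = d⁻¹ ∑_{j < d} (b_f)^j`. -/
def faceOperator (f : G.Face) : Module.End ℂ (Hilb E d) :=
  (d : ℂ)⁻¹ • ∑ j ∈ Finset.range d, toEnd (G.faceUnitary f) ^ j

variable (d)

/-- The Hamiltonian `-∑_v A_v - ∑_f B_f`. -/
def hamiltonian : Module.End ℂ (Hilb E d) :=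
  -(∑ v, G.vertexOperator v) - ∑ f, G.faceOperator f

/-- The lowest eigenvalue of the Hamiltonian. -/
def groundEnergy : ℝ := sInf {x : ℝ | (G.hamiltonian d).HasEigenvalue (x : ℂ)}

/-- The ground state space: the eigenspace of the lowest eigenvalue. -/
def groundSpace : Submodule ℂ (Hilb E d) :=
  (G.hamiltonian d).eigenspace (G.groundEnergy d : ℂ)

end PolygonDecomposition

end Operators

/-- Labels `(α, β)` of (co)homology classes. -/
abbrev Label (g d : ℕ) : Type := (Fin g → ZMod d) × (Fin g → ZMod d)

/-- The label `(v_i, 0)`. -/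
def lab₁ {g d : ℕ} (i : Fin g) : Label g d := (Pi.single i 1, 0)

/-- The label `(0, v_i)`. -/
def lab₂ {g d : ℕ} (i : Fin g) : Label g d := (0, Pi.single i 1)

/-- The multiplicative commutator. -/
def gcomm {U : Type*} [Group U] (A B : U) : U := A * B * A⁻¹ * B⁻¹

/-- The Weyl commutation relations: the commutators of
`Z_{v_i,0}`, `X_{0,v_i}` and of `Z_{0,v_i}`, `X_{v_i,0}` are `ω`, and all others are trivial. -/
structure WeylRelations {g d : ℕ} {K : Type*} [SeminormedAddCommGroup K] [Module ℂ K]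
    (Z X : Label g d → (K ≃ₗᵢ[ℂ] K)) : Prop where
  comm₁₂ : ∀ i, toEnd (gcomm (Z (lab₁ i)) (X (lab₂ i))) = omega d • (1 : Module.End ℂ K)
  comm₂₁ : ∀ i, toEnd (gcomm (Z (lab₂ i)) (X (lab₁ i))) = omega d • (1 : Module.End ℂ K)
  comm₁₂_ne : ∀ i j, i ≠ j → gcomm (Z (lab₁ i)) (X (lab₂ j)) = 1
  comm₂₁_ne : ∀ i j, i ≠ j → gcomm (Z (lab₂ i)) (X (lab₁ j)) = 1
  comm₁₁ : ∀ i j, gcomm (Z (lab₁ i)) (X (lab₁ j)) = 1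
  comm₂₂ : ∀ i j, gcomm (Z (lab₂ i)) (X (lab₂ j)) = 1
  commZ : ∀ i j, gcomm (Z (lab₁ i)) (Z (lab₁ j)) = 1 ∧ gcomm (Z (lab₁ i)) (Z (lab₂ j)) = 1 ∧
    gcomm (Z (lab₂ i)) (Z (lab₂ j)) = 1
  commX : ∀ i j, gcomm (X (lab₁ i)) (X (lab₁ j)) = 1 ∧ gcomm (X (lab₁ i)) (X (lab₂ j)) = 1 ∧
    gcomm (X (lab₂ i)) (X (lab₂ j)) = 1

end KitaevModel

end

open KitaevModel
open scoped TensorProduct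

/-! Homology is settled by one integral computation. The boundary matrices `D₁`, `D₂` satisfy `D₁ *
D₂ = 0`, and connectedness of the surface gives each of them a generalized inverse over `ℤ`. These
yield an integral idempotent `P` whose image is a complement of the boundaries in the cycles; its
trace is `2g` by the Euler characteristic, so `P = B * A` with `A * B = 1`
(`exists_homology_splitting`). Modulo `d`, for any `d`, the matrix `A` gives coordinates on homology
and `Bᵀ` coordinates on cohomology, and the pairing of cycles with cocycles becomes the dot product
on `(ℤ/d)^(2g)` (`HomologyFrame`).

All `a_v` and `b_f` are unitaries with `d`-th power one and have a common nonzero fixed vector.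
Averages of powers do not increase norms, so the ground states are exactly the common fixed vectors
(`mem_eigenspace_neg_sum_average`): functions supported on cocycles and invariant under
coboundaries, i.e. all functions on `H¹ ≅ (ℤ/d)^(2g)`. There `Z_γ` multiplies by a character and
`X_γ` translates (`HomologyFrame.weylModel`), which gives the dimension.

The rest concerns Weyl operators on functions on `(ℤ/d)^n`. By Fourier inversion they span all
operators (`span_weyl_eq_top`), whence generation of the algebra and cyclicity of every nonzero
vector. The commutator of a `Z` with an `X` is a faithful character of the pairing of their classes,
so the prescribed relations say that two labellings are dual for a nondegenerate form, and one
labelling determines the other (`weylRelations_iff`, `existsUnique_dual_labelling`). -/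

namespace KitaevModel

open Matrix

/-! ### Integral splitting of the cellular complex -/

/-- An idempotent integer matrix factors through a free module whose rank is its trace. -/
theorem exists_factorization_of_idempotent {ι : Type*} [Fintype ι] [DecidableEq ι]
    (P : Matrix ι ι ℤ) (hP : P * P = P) (n : ℕ) (htr : P.trace = n) :
    ∃ (A : Matrix (Fin n) ι ℤ) (B : Matrix ι (Fin n) ℤ), B * A = P ∧ A * B = 1 := by
  set f : (ι → ℤ) →ₗ[ℤ] (ι → ℤ) := Matrix.toLin' P with hf
  have hff : f ∘ₗ f = f := by rw [hf, ← Matrix.toLin'_mul, hP]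
  have hproj : LinearMap.IsProj (LinearMap.range f) f := by
    refine ⟨fun x => ⟨x, rfl⟩, ?_⟩
    rintro _ ⟨x, rfl⟩
    exact LinearMap.congr_fun hff x
  -- The range is free, being a submodule of a free module over a PID, so the trace of the
  -- projection is its rank.
  have hrank : Module.finrank ℤ (LinearMap.range f) = n := by
    have h := hproj.trace
    rw [hf, Matrix.trace_toLin'_eq, htr] at h
    exact_mod_cast h.symm
  let b := Module.finBasisOfFinrankEq ℤ (LinearMap.range f) hrank
  let p : (ι → ℤ) →ₗ[ℤ] (Fin n → ℤ) := b.equivFun.toLinearMap ∘ₗ f.rangeRestrict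
  let i : (Fin n → ℤ) →ₗ[ℤ] (ι → ℤ) := (LinearMap.range f).subtype ∘ₗ b.equivFun.symm.toLinearMap
  refine ⟨LinearMap.toMatrix' p, LinearMap.toMatrix' i, ?_, ?_⟩
  · rw [← LinearMap.toMatrix'_comp]
    have : i ∘ₗ p = f := by
      refine LinearMap.ext fun x => ?_
      simp [i, p]
    rw [this, hf, LinearMap.toMatrix'_toLin']
  · rw [← LinearMap.toMatrix'_comp, ← LinearMap.toMatrix'_id]
    congr 1
    refine LinearMap.ext fun x => ?_
    have : f.rangeRestrict (i x) = b.equivFun.symm x :=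
      Subtype.ext (hproj.map_id _ (b.equivFun.symm x).2)
    change b.equivFun (f.rangeRestrict (i x)) = x
    rw [this, LinearEquiv.apply_symm_apply]

/-- The signed incidence matrix of a labelling `o` of the darts. -/
def incidence {E Q : Type*} [DecidableEq Q] (o : E × Bool → Q) : Matrix Q E ℤ :=
  Matrix.of fun q e => (if o (e, false) = q then 1 else 0) - (if o (e, true) = q then 1 else 0)

lemma incidence_apply {E Q : Type*} [DecidableEq Q] (o : E × Bool → Q) (q : Q) (e : E) :
    incidence o q e = (if o (e, false) = q then 1 else 0) - (if o (e, true) = q then 1 else 0) :=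
  rfl

namespace PolygonDecomposition

variable {E : Type*} (G : PolygonDecomposition E)

/-- `vertexNext` takes `reverse E x` to `faceNext x`: the next side of a polygon begins where `x`
ends. -/
lemma origin_faceNext (x : E × Bool) : G.origin (G.faceNext x) = G.origin (reverse E x) := by
  refine (Quotient.sound (s := Equiv.Perm.SameCycle.setoid G.vertexNext) ⟨1, ?_⟩ :).symm
  obtain ⟨e, b⟩ := x
  simp [vertexNext, reverse]

lemma leftFace_faceNext (x : E × Bool) : G.leftFace (G.faceNext x) = G.leftFace x :=
  Quotient.sound (s := Equiv.Perm.SameCycle.setoid G.faceNext)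
    ((Equiv.Perm.SameCycle.refl _ x).apply_left)

variable [Fintype E]

/-- The boundary of the boundary of a face vanishes. -/
lemma incidence_origin_mul_incidence_leftFace :
    incidence G.origin * (incidence G.leftFace)ᵀ = 0 := by
  ext v f
  -- Regrouped by darts, each side of `f` contributes its start minus its end; the sum telescopes
  -- because `faceNext` permutes the sides of `f`.
  have h1 : (incidence G.origin * (incidence G.leftFace)ᵀ) v f =
      ∑ x : E × Bool, ((if G.leftFace x = f then 1 else 0) *
          (if G.origin x = v then (1 : ℤ) else 0) -
        (if G.leftFace x = f then 1 else 0) * (if G.origin (G.faceNext x) = v then 1 else 0)) := by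
    rw [Matrix.mul_apply, Fintype.sum_prod_type]
    refine Finset.sum_congr rfl fun e _ => ?_
    simp only [Fintype.sum_bool, origin_faceNext, Matrix.transpose_apply, incidence_apply, reverse,
      Equiv.prodCongr_apply, Prod.map_apply, Equiv.boolNot_apply, Bool.not_true, Bool.not_false,
      Equiv.refl_apply]
    ring
  rw [h1, Finset.sum_sub_distrib, ← Equiv.sum_comp G.faceNext]
  simp [leftFace_faceNext]

variable [DecidableEq E]

/-- A labelling of the darts that is constant along faces or along vertices detects the
connectedness of the surface: the differences of unit vectors are sums of columns of the incidence
matrix. -/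
lemma exists_incidence_mulVec {Q : Type*} [Fintype Q] [DecidableEq Q] (o : E × Bool → Q)
    (ho : ∀ x, o (G.faceNext x) = o x ∨ o (G.faceNext x) = o (reverse E x)) (x y : E × Bool) :
    ∃ c : E → ℤ, incidence o *ᵥ c = Pi.single (o y) 1 - Pi.single (o x) 1 := by
  have hrev : ∀ x, ∃ c : E → ℤ,
      incidence o *ᵥ c = Pi.single (o (reverse E x)) 1 - Pi.single (o x) 1 := by
    rintro ⟨e, b⟩
    have h1 : incidence o *ᵥ Pi.single e 1 =
        Pi.single (o (e, false)) 1 - Pi.single (o (e, true)) 1 := by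
      ext q
      simp [incidence_apply, Pi.single_apply, eq_comm]
    cases b
    · exact ⟨-Pi.single e 1, by rw [Matrix.mulVec_neg, h1]; simp [reverse]⟩
    · exact ⟨Pi.single e 1, by rw [h1]; simp [reverse]⟩
  obtain ⟨p, hp, rfl⟩ := G.connected x y
  -- Differences of unit vectors telescope along a word in the two generators.
  induction hp using Subgroup.closure_induction generalizing x with
  | mem p hp =>
    rcases hp with rfl | rfl
    · rcases ho x with h | h
      · exact ⟨0, by simp [h]⟩
      · rw [h]; exact hrev x
    · exact hrev x
  | one => exact ⟨0, by simp⟩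
  | mul p q _ _ ihp ihq =>
    obtain ⟨c, hc⟩ := ihp (q x)
    obtain ⟨c', hc'⟩ := ihq x
    exact ⟨c + c', by rw [Matrix.mulVec_add, hc, hc', Equiv.Perm.mul_apply]; abel⟩
  | inv p _ ih =>
    obtain ⟨c, hc⟩ := ih (p⁻¹ x)
    exact ⟨-c, by rw [Matrix.mulVec_neg, hc]; simp⟩

/-- Column `q` of `s` is a chain with boundary `q` minus a base point. Thus `incidence o * s` is the
identity minus a matrix of trace one, and that matrix annihilates boundaries because their
coordinates sum to zero. -/
lemma exists_incidence_section {Q : Type*} [Fintype Q] [DecidableEq Q] [Nonempty E]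
    (o : E × Bool → Q) (hs : Function.Surjective o)
    (ho : ∀ x, o (G.faceNext x) = o x ∨ o (G.faceNext x) = o (reverse E x)) :
    ∃ s : Matrix E Q ℤ, incidence o * s * incidence o = incidence o ∧
      (incidence o * s).trace = Fintype.card Q - 1 := by
  obtain ⟨e₀⟩ := ‹Nonempty E›
  set q₀ := o (e₀, true)
  have h : ∀ q, ∃ c : E → ℤ, incidence o *ᵥ c = Pi.single q 1 - Pi.single q₀ 1 := by
    intro q
    obtain ⟨y, rfl⟩ := hs q
    exact G.exists_incidence_mulVec o ho _ y
  choose c hc using h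
  have hsec : incidence o * (Matrix.of c)ᵀ =
      1 - Matrix.of fun q _ => (Pi.single q₀ 1 : Q → ℤ) q := by
    ext q r
    have := congrFun (hc r) q
    simp only [Matrix.mulVec, dotProduct, Pi.sub_apply] at this
    simp only [Matrix.mul_apply, Matrix.transpose_apply, Matrix.of_apply, Matrix.sub_apply, this]
    simp [Matrix.one_apply, Pi.single_apply]
  refine ⟨(Matrix.of c)ᵀ, ?_, ?_⟩
  · rw [hsec, Matrix.sub_mul, Matrix.one_mul, sub_eq_self]
    ext q e
    simp [Matrix.mul_apply, ← Finset.mul_sum, incidence_apply]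
  · rw [hsec, Matrix.trace_sub, Matrix.trace_one]
    simp [Matrix.trace, Pi.single_apply]

/-- Integral coordinates on the first homology: `A` and `B` are mutually inverse modulo
boundaries. -/
theorem exists_homology_splitting [Nonempty E] {g : ℕ} (hg : G.HasGenus g) :
    ∃ (A : Matrix (Fin (2 * g)) E ℤ) (B : Matrix E (Fin (2 * g)) ℤ) (s : Matrix E G.Vertex ℤ)
      (u : Matrix G.Face E ℤ), A * B = 1 ∧
      B * A + s * incidence G.origin + (incidence G.leftFace)ᵀ * u = 1 ∧
      A * (incidence G.leftFace)ᵀ = 0 ∧ incidence G.origin * B = 0 := by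
  obtain ⟨s, hs, hst⟩ := G.exists_incidence_section G.origin Quotient.mk_surjective
    fun x => .inr (G.origin_faceNext x)
  obtain ⟨t', ht', htt'⟩ := G.exists_incidence_section G.leftFace Quotient.mk_surjective
    fun x => .inl (G.leftFace_faceNext x)
  have h12 := G.incidence_origin_mul_incidence_leftFace
  set D₁ := incidence G.origin
  obtain ⟨t, rfl⟩ : ∃ t, t' = tᵀ := ⟨t'ᵀ, rfl⟩
  obtain ⟨D₂, hD₂⟩ : ∃ D₂, D₂ = (incidence G.leftFace)ᵀ := ⟨_, rfl⟩
  have hD₂' : incidence G.leftFace = D₂ᵀ := by rw [hD₂, Matrix.transpose_transpose]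
  rw [hD₂'] at ht' htt'
  rw [← hD₂] at h12 ⊢
  have ht : D₂ * t * D₂ = D₂ := by
    apply Matrix.transpose_injective
    rw [Matrix.transpose_mul, Matrix.transpose_mul, ← Matrix.mul_assoc, ht']
  have htt : (t * D₂).trace = Fintype.card G.Face - 1 := by
    rw [← htt', ← Matrix.transpose_mul, Matrix.trace_transpose]
  -- This is `(1 - D₂ * t) * (1 - s * D₁)`: project onto the cycles, then remove a boundary so that
  -- boundaries are killed.
  set P := 1 - s * D₁ - D₂ * t * (1 - s * D₁) with hPdef
  have hD₁P : D₁ * P = 0 := by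
    rw [hPdef, Matrix.mul_sub, Matrix.mul_sub, Matrix.mul_one, ← Matrix.mul_assoc, hs,
      ← Matrix.mul_assoc, ← Matrix.mul_assoc, h12]
    simp
  have hPD₂ : P * D₂ = 0 := by
    have : (1 - s * D₁) * D₂ = D₂ := by
      rw [Matrix.sub_mul, Matrix.mul_assoc, h12]; simp
    rw [hPdef, Matrix.sub_mul, this, Matrix.mul_assoc, this, ht, sub_self]
  have hPP : P * P = P := by
    nth_rewrite 2 [hPdef]
    rw [Matrix.mul_sub, Matrix.mul_assoc D₂, ← Matrix.mul_assoc P, hPD₂, Matrix.zero_mul, sub_zero]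
    have : P * (1 - s * D₁) = (1 - s * D₁) * (1 - s * D₁) -
      D₂ * t * ((1 - s * D₁) * (1 - s * D₁)) := by
      rw [hPdef, Matrix.sub_mul, Matrix.mul_assoc (D₂ * t)]
    have hidem : (1 - s * D₁) * (1 - s * D₁) = 1 - s * D₁ := by
      rw [Matrix.mul_sub, Matrix.mul_one, Matrix.sub_mul, Matrix.one_mul, Matrix.mul_assoc s,
        ← Matrix.mul_assoc D₁, hs, sub_self, sub_zero]
    rw [this, hidem]
  -- The cross term has trace zero by cyclicity and `D₁ * D₂ = 0`, which leaves `|E| - (|V| - 1) -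
  -- (|F| - 1) = 2g`.
  have htr : P.trace = (2 * g : ℕ) := by
    have h1 : (D₂ * t * (s * D₁)).trace = 0 := by
      rw [← Matrix.mul_assoc, Matrix.trace_mul_comm, ← Matrix.mul_assoc, ← Matrix.mul_assoc, h12]
      simp
    rw [hPdef, Matrix.mul_sub, Matrix.mul_one, Matrix.trace_sub, Matrix.trace_sub,
      Matrix.trace_sub, h1, Matrix.trace_one, Matrix.trace_mul_comm s, hst,
      Matrix.trace_mul_comm D₂, htt]
    have := hg
    unfold HasGenus at this
    push_cast
    linarith
  obtain ⟨A, B, hBA, hAB⟩ := exists_factorization_of_idempotent P hPP _ htr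
  refine ⟨A, B, s, t * (1 - s * D₁), hAB, ?_, ?_, ?_⟩
  · rw [hBA, hPdef, ← Matrix.mul_assoc]; abel
  · have : A = A * P := by rw [← hBA, ← Matrix.mul_assoc, hAB, Matrix.one_mul]
    rw [this, Matrix.mul_assoc, hPD₂, Matrix.mul_zero]
  · have : B = P * B := by rw [← hBA, Matrix.mul_assoc, hAB, Matrix.mul_one]
    rw [this, ← Matrix.mul_assoc, hD₁P, Matrix.zero_mul]

end PolygonDecomposition

/-! ### Cycles and boundaries of the decomposition and of its dual -/

namespace PolygonDecomposition

variable {E : Type*} (G : PolygonDecomposition E)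

/-- Vertices of the dual are faces. -/
def dualVertexEquiv : G.dual.Vertex ≃ G.Face :=
  Quotient.congr (reverse E) fun x y => by
    change (G.vertexNext⁻¹ * reverse E).SameCycle x y ↔ G.faceNext.SameCycle _ _
    have h : G.vertexNext⁻¹ * reverse E = reverse E * G.faceNext⁻¹ * (reverse E)⁻¹ := by
      simp [vertexNext, _root_.mul_inv_rev, reverse_inv]
    rw [h, Equiv.Perm.sameCycle_conj, reverse_inv, Equiv.Perm.sameCycle_inv]

lemma dualVertexEquiv_origin (x : E × Bool) :
    G.dualVertexEquiv (G.dual.origin x) = G.leftFace (reverse E x) := rfl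

/-- Faces of the dual are vertices. -/
def dualFaceEquiv : G.dual.Face ≃ G.Vertex :=
  Quotient.congr (Equiv.refl _) fun _ _ => Equiv.Perm.sameCycle_inv

lemma dualFaceEquiv_leftFace (x : E × Bool) :
    G.dualFaceEquiv (G.dual.leftFace x) = G.origin x := rfl

/-- The sign arises because a dual edge runs from the right face to the left one, while `incidence
G.leftFace` counts right minus left. -/
lemma incidence_dual_origin :
    incidence G.dual.origin = -(incidence G.leftFace).submatrix G.dualVertexEquiv id := by
  ext u e
  simp only [incidence_apply, Matrix.neg_apply, Matrix.submatrix_apply,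
    ← G.dualVertexEquiv.apply_eq_iff_eq, dualVertexEquiv_origin]
  simp [reverse]

lemma incidence_dual_leftFace :
    incidence G.dual.leftFace = (incidence G.origin).submatrix G.dualFaceEquiv id := by
  ext u e
  simp only [incidence_apply, Matrix.submatrix_apply,
    ← G.dualFaceEquiv.apply_eq_iff_eq, dualFaceEquiv_leftFace]
  simp

variable [Fintype E] {d : ℕ}

lemma mem_cycles_iff {γ : E → ZMod d} :
    γ ∈ G.cycles d ↔ (incidence G.origin).map (Int.cast : ℤ → ZMod d) *ᵥ γ = 0 := by
  have : G.boundary₁ d γ = (incidence G.origin).map (Int.cast : ℤ → ZMod d) *ᵥ γ := by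
    ext v
    simp only [boundary₁, Fintype.linearCombination_apply, Finset.sum_apply, Matrix.mulVec,
      dotProduct, Matrix.map_apply, incidence_apply]
    refine Finset.sum_congr rfl fun e _ => ?_
    simp [head, tail, Pi.single_apply, mul_comm, eq_comm]
  rw [cycles, LinearMap.mem_ker, this]

/-- `boundary₂` counts left minus right, so it is minus the transposed incidence matrix; the range
does not see the sign. -/
lemma mem_boundaries_iff {γ : E → ZMod d} :
    γ ∈ G.boundaries d ↔
      ∃ c, (incidence G.leftFace)ᵀ.map (Int.cast : ℤ → ZMod d) *ᵥ c = γ := by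
  have : ∀ c, G.boundary₂ d c = (incidence G.leftFace)ᵀ.map (Int.cast : ℤ → ZMod d) *ᵥ (-c) := by
    intro c
    ext e
    simp only [boundary₂, Fintype.linearCombination_apply, Finset.sum_apply, Matrix.mulVec,
      dotProduct, Matrix.map_apply, Matrix.transpose_apply, incidence_apply]
    refine Finset.sum_congr rfl fun f _ => ?_
    by_cases h : G.leftFace (e, true) = f <;> by_cases h' : G.leftFace (e, false) = f <;>
      simp [left, right, h, h']
  constructor
  · rintro ⟨c, rfl⟩
    exact ⟨-c, (this c).symm⟩
  · rintro ⟨c, rfl⟩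
    exact ⟨-c, by rw [this, neg_neg]⟩

/-- A kernel is insensitive to sign and reindexing, so cocycles are governed by the face matrix of
`G` itself and the splitting of `G` also serves its dual. -/
lemma mem_dual_cycles_iff {γ : E → ZMod d} :
    γ ∈ G.dual.cycles d ↔ (incidence G.leftFace).map (Int.cast : ℤ → ZMod d) *ᵥ γ = 0 := by
  rw [mem_cycles_iff, incidence_dual_origin]
  have : (-(incidence G.leftFace).submatrix G.dualVertexEquiv id).map (Int.cast : ℤ → ZMod d) *ᵥ γ
      = -(((incidence G.leftFace).map (Int.cast : ℤ → ZMod d) *ᵥ γ) ∘ G.dualVertexEquiv) := by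
    ext u
    simp [Matrix.mulVec, dotProduct]
  rw [this, neg_eq_zero]
  constructor
  · intro h
    ext f
    simpa using congrFun h (G.dualVertexEquiv.symm f)
  · intro h
    rw [h]; rfl

lemma mem_dual_boundaries_iff {γ : E → ZMod d} :
    γ ∈ G.dual.boundaries d ↔
      ∃ c, (incidence G.origin)ᵀ.map (Int.cast : ℤ → ZMod d) *ᵥ c = γ := by
  rw [mem_boundaries_iff, incidence_dual_leftFace]
  have : ∀ c, ((incidence G.origin).submatrix G.dualFaceEquiv id)ᵀ.map (Int.cast : ℤ → ZMod d) *ᵥ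
      (c ∘ G.dualFaceEquiv) = (incidence G.origin)ᵀ.map (Int.cast : ℤ → ZMod d) *ᵥ c := by
    intro c
    ext e
    simp only [Matrix.mulVec, dotProduct, Matrix.map_apply, Matrix.transpose_apply,
      Matrix.submatrix_apply, Function.comp_apply, id]
    exact Equiv.sum_comp G.dualFaceEquiv fun v => ((incidence G.origin v e : ℤ) : ZMod d) * c v
  constructor
  · rintro ⟨c, rfl⟩
    refine ⟨c ∘ G.dualFaceEquiv.symm, ?_⟩
    rw [← this]
    congr 1
    ext; simp
  · rintro ⟨c, rfl⟩
    exact ⟨c ∘ G.dualFaceEquiv, this c⟩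

end PolygonDecomposition

/-! ### Dual coordinates with coefficients in `ℤ/d` -/

/-- Dual coordinates on the first homology and cohomology with coefficients in `ℤ/d`: the matrix `A`
gives the coordinates of cycles and `Bᵀ` those of cocycles. -/
structure HomologyFrame {E : Type*} [Fintype E] (G : PolygonDecomposition E) (n d : ℕ) where
  A : Matrix (Fin n) E (ZMod d)
  B : Matrix E (Fin n) (ZMod d)
  A_mul_B : A * B = 1
  A_boundary : ∀ γ ∈ G.boundaries d, A *ᵥ γ = 0
  B_mem : ∀ w, B *ᵥ w ∈ G.cycles d
  sub_mem : ∀ γ ∈ G.cycles d, γ - B *ᵥ (A *ᵥ γ) ∈ G.boundaries d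
  B_boundary : ∀ γ ∈ G.dual.boundaries d, Bᵀ *ᵥ γ = 0
  A_mem : ∀ w, Aᵀ *ᵥ w ∈ G.dual.cycles d
  sub_mem_dual : ∀ γ ∈ G.dual.cycles d, γ - Aᵀ *ᵥ (Bᵀ *ᵥ γ) ∈ G.dual.boundaries d
  pairing : ∀ γ ∈ G.cycles d, ∀ γ' ∈ G.dual.cycles d, γ ⬝ᵥ γ' = (A *ᵥ γ) ⬝ᵥ (Bᵀ *ᵥ γ')

lemma intCast_map_mul (R : Type*) [CommRing R] {l m k : Type*} [Fintype m] (M : Matrix l m ℤ)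
    (N : Matrix m k ℤ) :
    (M * N).map (Int.cast : ℤ → R) = M.map (Int.cast : ℤ → R) * N.map (Int.cast : ℤ → R) :=
  Matrix.map_mul (f := Int.castRingHom R)

/-- The consequences, for vectors over a commutative ring, of an integral splitting of a complex
with differentials `D₁` and `D₂ᵀ`. -/
lemma splitting_mulVec (R : Type*) [CommRing R] {ι V F W : Type*} [Fintype ι] [DecidableEq ι]
    [Fintype V] [Fintype F] [Fintype W] [DecidableEq W]
    {A : Matrix W ι ℤ} {B : Matrix ι W ℤ} {s : Matrix ι V ℤ} {u : Matrix F ι ℤ}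
    {D₁ : Matrix V ι ℤ} {D₂ : Matrix F ι ℤ} (h1 : A * B = 1)
    (h2 : B * A + s * D₁ + D₂ᵀ * u = 1) (h3 : A * D₂ᵀ = 0) (h4 : D₁ * B = 0) :
    ∃ (A' : Matrix W ι R) (B' : Matrix ι W R) (s' : Matrix V ι R) (u' : Matrix F ι R),
      A' * B' = 1 ∧ (∀ c, A' *ᵥ (D₂ᵀ.map (Int.cast : ℤ → R) *ᵥ c) = 0) ∧
      (∀ c, B'ᵀ *ᵥ (D₁ᵀ.map (Int.cast : ℤ → R) *ᵥ c) = 0) ∧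
      (∀ w, D₁.map (Int.cast : ℤ → R) *ᵥ (B' *ᵥ w) = 0) ∧
      (∀ w, D₂.map (Int.cast : ℤ → R) *ᵥ (A'ᵀ *ᵥ w) = 0) ∧
      (∀ γ, D₁.map (Int.cast : ℤ → R) *ᵥ γ = 0 →
        D₂ᵀ.map (Int.cast : ℤ → R) *ᵥ (u' *ᵥ γ) = γ - B' *ᵥ (A' *ᵥ γ)) ∧
      (∀ γ, D₂.map (Int.cast : ℤ → R) *ᵥ γ = 0 →
        D₁ᵀ.map (Int.cast : ℤ → R) *ᵥ (s' *ᵥ γ) = γ - A'ᵀ *ᵥ (B'ᵀ *ᵥ γ)) ∧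
      ∀ γ γ', D₁.map (Int.cast : ℤ → R) *ᵥ γ = 0 → D₂.map (Int.cast : ℤ → R) *ᵥ γ' = 0 →
        γ ⬝ᵥ γ' = (A' *ᵥ γ) ⬝ᵥ (B'ᵀ *ᵥ γ') := by
  have hAB := intCast_map_mul R A B
  have hBA := intCast_map_mul R B A
  have hs := intCast_map_mul R s D₁
  have hu := intCast_map_mul R D₂ᵀ u
  have hA := intCast_map_mul R A D₂ᵀ
  have hB := intCast_map_mul R D₁ B
  rw [h1, Matrix.map_one _ Int.cast_zero Int.cast_one] at hAB
  rw [h3, Matrix.map_zero _ Int.cast_zero] at hA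
  rw [h4, Matrix.map_zero _ Int.cast_zero] at hB
  have h2' := congrArg (fun M => M.map (Int.cast : ℤ → R)) h2
  simp only [Matrix.map_add _ Int.cast_add, hBA, hs, hu,
    Matrix.map_one _ Int.cast_zero Int.cast_one] at h2'
  clear h1 h2 h3 h4 hBA hs hu
  simp only [Matrix.transpose_map] at hA h2' ⊢
  generalize A.map (Int.cast : ℤ → R) = A at *
  generalize B.map (Int.cast : ℤ → R) = B at *
  generalize s.map (Int.cast : ℤ → R) = s at *
  generalize u.map (Int.cast : ℤ → R) = u at *
  generalize D₁.map (Int.cast : ℤ → R) = D₁ at *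
  generalize D₂.map (Int.cast : ℤ → R) = D₂ at *
  have hcyc : ∀ γ, D₁ *ᵥ γ = 0 → γ = B *ᵥ (A *ᵥ γ) + D₂ᵀ *ᵥ (u *ᵥ γ) := by
    intro γ hγ
    have := congrArg (· *ᵥ γ) h2'
    simp only [Matrix.add_mulVec, ← Matrix.mulVec_mulVec, Matrix.one_mulVec, hγ,
      Matrix.mulVec_zero, add_zero] at this
    exact this.symm
  -- Cohomology uses the transpose of the same splitting identity, with the roles of `s` and `u`
  -- exchanged.
  have hcoc : ∀ γ, D₂ *ᵥ γ = 0 → γ = Aᵀ *ᵥ (Bᵀ *ᵥ γ) + D₁ᵀ *ᵥ (sᵀ *ᵥ γ) := by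
    intro γ hγ
    have := congrArg (· *ᵥ γ) (congrArg Matrix.transpose h2')
    simp only [Matrix.transpose_add, Matrix.transpose_mul, Matrix.transpose_transpose,
      Matrix.transpose_one, Matrix.add_mulVec, ← Matrix.mulVec_mulVec, Matrix.one_mulVec,
      hγ, Matrix.mulVec_zero, add_zero] at this
    exact this.symm
  refine ⟨A, B, sᵀ, u, hAB.symm, ?_, ?_, ?_, ?_, ?_, ?_, ?_⟩
  · intro c
    rw [Matrix.mulVec_mulVec, ← hA, Matrix.zero_mulVec]
  · intro c
    rw [Matrix.mulVec_mulVec, ← Matrix.transpose_mul, ← hB, Matrix.transpose_zero,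
      Matrix.zero_mulVec]
  · intro w
    rw [Matrix.mulVec_mulVec, ← hB, Matrix.zero_mulVec]
  · intro w
    rw [Matrix.mulVec_mulVec, ← Matrix.transpose_transpose D₂, ← Matrix.transpose_mul, ← hA,
      Matrix.transpose_zero, Matrix.zero_mulVec]
  · intro γ hγ
    exact eq_sub_of_add_eq' (hcyc γ hγ).symm
  · intro γ hγ
    exact eq_sub_of_add_eq' (hcoc γ hγ).symm
  · intro γ γ' hγ hγ'
    -- The boundary part of `γ` pairs to zero with the cocycle `γ'`.
    nth_rewrite 1 [hcyc γ hγ]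
    rw [add_dotProduct, Matrix.mulVec_transpose D₂, ← Matrix.dotProduct_mulVec, hγ',
      dotProduct_zero, add_zero, Matrix.mulVec_transpose B, dotProduct_comm,
      Matrix.dotProduct_mulVec, dotProduct_comm]

theorem PolygonDecomposition.exists_homologyFrame {E : Type*} [Fintype E] [DecidableEq E]
    [Nonempty E] (G : PolygonDecomposition E) {g : ℕ} (hg : G.HasGenus g) (d : ℕ) :
    Nonempty (HomologyFrame G (2 * g) d) := by
  obtain ⟨A, B, s, u, h1, h2, h3, h4⟩ := G.exists_homology_splitting hg
  obtain ⟨A, B, s, u, h1, h2, h3, h4, h5, h6, h7, h8⟩ := splitting_mulVec (ZMod d) h1 h2 h3 h4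
  refine ⟨⟨A, B, h1, ?_, fun w => G.mem_cycles_iff.2 (h4 w),
    fun γ hγ => G.mem_boundaries_iff.2 ⟨_, h6 γ (G.mem_cycles_iff.1 hγ)⟩, ?_,
    fun w => G.mem_dual_cycles_iff.2 (h5 w),
    fun γ hγ => G.mem_dual_boundaries_iff.2 ⟨_, h7 γ (G.mem_dual_cycles_iff.1 hγ)⟩,
    fun γ hγ γ' hγ' => h8 γ γ' (G.mem_cycles_iff.1 hγ) (G.mem_dual_cycles_iff.1 hγ')⟩⟩
  · intro γ hγ
    obtain ⟨c, rfl⟩ := G.mem_boundaries_iff.1 hγ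
    exact h2 c
  · intro γ hγ
    obtain ⟨c, rfl⟩ := G.mem_dual_boundaries_iff.1 hγ
    exact h3 c

/-! ### String operators as translations and characters -/

lemma omega_pow_val {d : ℕ} [NeZero d] (j : ZMod d) : omega d ^ j.val = ZMod.stdAddChar j := by
  rw [ZMod.stdAddChar_apply, ZMod.toCircle_apply, omega, ← Complex.exp_nat_mul]
  congr 1
  ring

lemma omega_eq_stdAddChar {d : ℕ} [NeZero d] : omega d = ZMod.stdAddChar (1 : ZMod d) := by
  have := ZMod.stdAddChar_coe (N := d) 1
  rw [Int.cast_one] at this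
  rw [this, omega]
  congr 1
  push_cast
  ring

section Operators

variable {E : Type*} [Fintype E] [DecidableEq E] {d : ℕ}

lemma prod_ofAdd_single_zpow (n : E → ℤ) :
    ∏ e, (Multiplicative.ofAdd (Pi.single e (1 : ZMod d) : E → ZMod d)) ^ n e =
      Multiplicative.ofAdd fun e => (n e : ZMod d) := by
  apply Multiplicative.toAdd.injective
  ext e
  simp [toAdd_prod, Finset.sum_apply, Pi.single_apply]

variable [NeZero d]

/-- Translation by a cochain. -/
noncomputable def shift (c : E → ZMod d) : Hilb E d ≃ₗᵢ[ℂ] Hilb E d :=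
  LinearIsometryEquiv.piLpCongrLeft 2 ℂ ℂ (Equiv.addRight c)

lemma shift_apply (c : E → ZMod d) (ψ : Hilb E d) (k : E → ZMod d) :
    shift c ψ k = ψ (k - c) := by
  simp [shift, LinearIsometryEquiv.piLpCongrLeft_apply, Equiv.piCongrLeft', sub_eq_add_neg]

noncomputable def shiftHom : Multiplicative (E → ZMod d) →* (Hilb E d ≃ₗᵢ[ℂ] Hilb E d) where
  toFun c := shift c.toAdd
  map_one' := by
    ext ψ k
    simp [shift_apply]
  map_mul' a b := by
    ext ψ k
    simp [shift_apply, sub_sub]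

/-- Multiplication by the character of a chain. -/
noncomputable def modulate (c : E → ZMod d) : Hilb E d ≃ₗᵢ[ℂ] Hilb E d :=
  LinearIsometryEquiv.piLpCongrRight 2 fun k =>
    phase (ZMod.stdAddChar (c ⬝ᵥ k)) (by rw [ZMod.stdAddChar_apply, Circle.norm_coe])

lemma modulate_apply (c : E → ZMod d) (ψ : Hilb E d) (k : E → ZMod d) :
    modulate c ψ k = ZMod.stdAddChar (c ⬝ᵥ k) * ψ k := by
  simp [modulate, phase]

noncomputable def modulateHom : Multiplicative (E → ZMod d) →* (Hilb E d ≃ₗᵢ[ℂ] Hilb E d) where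
  toFun c := modulate c.toAdd
  map_one' := by
    ext ψ k
    simp [modulate_apply]
  map_mul' a b := by
    ext ψ k
    simp [modulate_apply, AddChar.map_add_eq_mul, add_dotProduct, mul_assoc]

lemma siteZ_eq_modulate (e : E) :
    (siteZ e : Hilb E d ≃ₗᵢ[ℂ] Hilb E d) = modulate (Pi.single e 1) := by
  ext ψ k
  simp [modulate_apply, siteZ, phase, omega_pow_val]

/-- The product over edges is the image under `shiftHom` of a product in a commutative group, where
it is evaluated coordinatewise. -/
lemma prodX_eq_shift (n : E → ℤ) :
    (prodX n : Hilb E d ≃ₗᵢ[ℂ] Hilb E d) = shift fun e => (n e : ZMod d) := by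
  change _ = shiftHom (.ofAdd fun e => (n e : ZMod d))
  rw [← prod_ofAdd_single_zpow, ← Finset.noncommProd_eq_prod]
  refine Eq.trans ?_ (Finset.map_noncommProd Finset.univ _ _
    (shiftHom (E := E) (d := d))).symm
  refine Finset.noncommProd_congr rfl (fun e _ => ?_) _
  rw [map_zpow]
  rfl

lemma prodZ_eq_modulate (n : E → ℤ) :
    (prodZ n : Hilb E d ≃ₗᵢ[ℂ] Hilb E d) = modulate fun e => (n e : ZMod d) := by
  change _ = modulateHom (.ofAdd fun e => (n e : ZMod d))
  rw [← prod_ofAdd_single_zpow, ← Finset.noncommProd_eq_prod]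
  refine Eq.trans ?_ (Finset.map_noncommProd Finset.univ _ _
    (modulateHom (E := E) (d := d))).symm
  refine Finset.noncommProd_congr rfl (fun e _ => ?_) _
  rw [map_zpow, siteZ_eq_modulate]
  rfl

lemma stringX_apply (γ : E → ZMod d) (ψ : Hilb E d) (k : E → ZMod d) :
    stringX γ ψ k = ψ (k - γ) := by
  rw [stringX, prodX_eq_shift, shift_apply]
  simp [Pi.sub_def]

lemma stringZ_apply (γ : E → ZMod d) (ψ : Hilb E d) (k : E → ZMod d) :
    stringZ γ ψ k = ZMod.stdAddChar (γ ⬝ᵥ k) * ψ k := by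
  rw [stringZ, prodZ_eq_modulate, modulate_apply]
  simp

lemma shift_pow_eq_one (c : E → ZMod d) : shift c ^ d = 1 := by
  change shiftHom (.ofAdd c) ^ d = 1
  rw [← map_pow, ← ofAdd_nsmul]
  have : d • c = 0 := by ext; simp
  rw [this, ofAdd_zero, map_one]

lemma modulate_pow_eq_one (c : E → ZMod d) : modulate c ^ d = 1 := by
  change modulateHom (.ofAdd c) ^ d = 1
  rw [← map_pow, ← ofAdd_nsmul]
  have : d • c = 0 := by ext; simp
  rw [this, ofAdd_zero, map_one]

end Operators

/-! ### Lowest eigenspace of minus a sum of averages -/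

section Averaging

variable {K : Type*} [NormedAddCommGroup K] [InnerProductSpace ℂ K]

/-- The average of the first `d` powers of a unitary. -/
noncomputable def average (d : ℕ) (U : K ≃ₗᵢ[ℂ] K) : Module.End ℂ K :=
  (d : ℂ)⁻¹ • ∑ j ∈ Finset.range d, toEnd U ^ j

lemma toEnd_pow_apply (U : K ≃ₗᵢ[ℂ] K) (j : ℕ) (ψ : K) : (toEnd U ^ j) ψ = (U ^ j) ψ := by
  induction j generalizing ψ with
  | zero => rfl
  | succ j ih => rw [pow_succ, pow_succ, Module.End.mul_apply, ih]; rfl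

lemma average_apply (d : ℕ) (U : K ≃ₗᵢ[ℂ] K) (ψ : K) :
    average d U ψ = (d : ℂ)⁻¹ • ∑ j ∈ Finset.range d, (U ^ j) ψ := by
  simp [average, LinearMap.sum_apply, toEnd_pow_apply]

lemma norm_average_le {d : ℕ} [NeZero d] (U : K ≃ₗᵢ[ℂ] K) (ψ : K) : ‖average d U ψ‖ ≤ ‖ψ‖ := by
  have hd : (0 : ℝ) < d := Nat.cast_pos.2 (NeZero.pos d)
  rw [average_apply, norm_smul, norm_inv, Complex.norm_natCast, inv_mul_le_iff₀ hd]
  refine (norm_sum_le _ _).trans ?_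
  simp

/-- Since `U ^ d = 1`, applying `U` permutes the averaged powers cyclically, so every average is
fixed by `U`. -/
lemma average_eq_self_iff {d : ℕ} [NeZero d] {U : K ≃ₗᵢ[ℂ] K} (hU : U ^ d = 1) {ψ : K} :
    average d U ψ = ψ ↔ U ψ = ψ := by
  have hd : (d : ℂ) ≠ 0 := Nat.cast_ne_zero.2 (NeZero.ne d)
  constructor
  · intro h
    have key : U (average d U ψ) = average d U ψ := by
      rw [average_apply, map_smul, map_sum]
      congr 1
      have h1 := Finset.sum_range_succ (fun j => (U ^ j) ψ) d
      rw [Finset.sum_range_succ', hU, pow_zero, add_left_inj] at h1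
      rw [← h1]
      refine Finset.sum_congr rfl fun j _ => ?_
      rw [pow_succ']
      rfl
    rwa [h] at key
  · intro h
    have hj : ∀ j, (U ^ j) ψ = ψ := by
      intro j
      induction j with
      | zero => rfl
      | succ j ih => rw [pow_succ]; exact (congrArg _ h).trans ih
    rw [average_apply, Finset.sum_congr rfl fun j _ => hj j]
    simp [← Nat.cast_smul_eq_nsmul ℂ, smul_smul, hd]

variable {ι : Type*} [Fintype ι] {d : ℕ} [NeZero d]

lemma re_inner_average_le (U : K ≃ₗᵢ[ℂ] K) (ψ : K) :
    RCLike.re (inner ℂ ψ (average d U ψ)) ≤ ‖ψ‖ ^ 2 := by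
  calc RCLike.re (inner ℂ ψ (average d U ψ)) ≤ ‖ψ‖ * ‖average d U ψ‖ := re_inner_le_norm _ _
    _ ≤ ‖ψ‖ * ‖ψ‖ := by gcongr; exact norm_average_le U ψ
    _ = ‖ψ‖ ^ 2 := (sq _).symm

/-- Equality case of Cauchy–Schwarz: expanding the squared distance between `ψ` and its average
leaves at most zero. That the average is a projection is not needed. -/
lemma average_eq_self_of_le {U : K ≃ₗᵢ[ℂ] K} {ψ : K}
    (h : ‖ψ‖ ^ 2 ≤ RCLike.re (inner ℂ ψ (average d U ψ))) : average d U ψ = ψ := by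
  have h1 := norm_sub_sq (𝕜 := ℂ) ψ (average d U ψ)
  have h2 := norm_average_le (d := d) U ψ
  have h3 : ‖average d U ψ‖ ^ 2 ≤ ‖ψ‖ ^ 2 := by gcongr
  have h4 : ‖ψ - average d U ψ‖ ^ 2 ≤ 0 := by linarith
  have h5 : ‖ψ - average d U ψ‖ = 0 := by
    have := sq_nonneg ‖ψ - average d U ψ‖
    exact pow_eq_zero_iff two_ne_zero |>.1 (le_antisymm h4 this)
  exact (sub_eq_zero.1 (norm_eq_zero.1 h5)).symm

/-- The eigenspace of the lowest eigenvalue of minus a sum of averages is the space of common fixed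
vectors, provided that the latter is nonzero. -/
theorem mem_eigenspace_neg_sum_average (U : ι → K ≃ₗᵢ[ℂ] K) (hU : ∀ i, U i ^ d = 1)
    (hne : ∃ ψ : K, ψ ≠ 0 ∧ ∀ i, U i ψ = ψ) (ψ : K) :
    ψ ∈ (-∑ i, average d (U i)).eigenspace
        ((sInf {x : ℝ | (-∑ i, average d (U i)).HasEigenvalue (x : ℂ)} : ℝ) : ℂ) ↔
      ∀ i, U i ψ = ψ := by
  have apply_fixed : ∀ φ : K, (∀ i, U i φ = φ) →
      (-∑ i, average d (U i)) φ = ((-(Fintype.card ι : ℝ) : ℝ) : ℂ) • φ := by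
    intro φ h
    rw [LinearMap.neg_apply, LinearMap.sum_apply,
      Finset.sum_congr rfl fun i _ => (average_eq_self_iff (hU i)).2 (h i)]
    simp [← Nat.cast_smul_eq_nsmul ℂ]
  have inner_eq : ∀ (φ : K) (x : ℝ), (-∑ i, average d (U i)) φ = (x : ℂ) • φ →
      -∑ i, RCLike.re (inner ℂ φ (average d (U i) φ)) = x * ‖φ‖ ^ 2 := by
    intro φ x h
    have := congrArg (fun χ => RCLike.re (inner ℂ φ χ)) h
    simp only [LinearMap.neg_apply, LinearMap.sum_apply, inner_neg_right, inner_sum,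
      inner_smul_right, map_neg, map_sum] at this
    rw [this, inner_self_eq_norm_sq_to_K]
    have h1 := Complex.ofReal_re (x * ‖φ‖ ^ 2)
    push_cast at h1
    exact h1
  -- Each average lowers the energy by at most `‖φ‖ ^ 2`; the common fixed vector from `hne` attains
  -- the bound.
  have hmin : sInf {x : ℝ | (-∑ i, average d (U i)).HasEigenvalue (x : ℂ)} =
      -(Fintype.card ι : ℝ) := by
    refine IsLeast.csInf_eq ⟨?_, ?_⟩
    · obtain ⟨φ, hφ, h⟩ := hne
      exact Module.End.hasEigenvalue_of_hasEigenvector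
        ⟨Module.End.mem_eigenspace_iff.2 (apply_fixed φ h), hφ⟩
    · intro x hx
      obtain ⟨φ, hφ, hφ0⟩ := hx.exists_hasEigenvector
      have h1 := inner_eq φ x (Module.End.mem_eigenspace_iff.1 hφ)
      have h2 : ∑ i, RCLike.re (inner ℂ φ (average d (U i) φ)) ≤ Fintype.card ι * ‖φ‖ ^ 2 := by
        refine (Finset.sum_le_sum fun i _ => re_inner_average_le (U i) φ).trans ?_
        simp
      have h3 : 0 < ‖φ‖ ^ 2 := by positivity
      nlinarith
  rw [hmin, Module.End.mem_eigenspace_iff]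
  refine ⟨fun h i => ?_, apply_fixed ψ⟩
  have h1 := inner_eq ψ _ h
  have h2 : ∑ i, RCLike.re (inner ℂ ψ (average d (U i) ψ)) = ∑ _i : ι, ‖ψ‖ ^ 2 := by
    rw [Finset.sum_const, Finset.card_univ, nsmul_eq_mul]
    linarith
  -- Equality in the sum of termwise bounds forces equality in each term.
  have h3 := (Finset.sum_eq_sum_iff_of_le fun i _ => re_inner_average_le (U i) ψ).1 h2 i
    (Finset.mem_univ i)
  exact (average_eq_self_iff (hU i)).1 (average_eq_self_of_le h3.ge)

end Averaging

/-! ### Description of the ground states -/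

namespace PolygonDecomposition

variable {E : Type*} [Fintype E] (G : PolygonDecomposition E) {d : ℕ}

lemma boundaries_le_cycles : G.boundaries d ≤ G.cycles d := by
  intro γ hγ
  obtain ⟨c, rfl⟩ := G.mem_boundaries_iff.1 hγ
  have h := intCast_map_mul (ZMod d) (incidence G.origin) (incidence G.leftFace)ᵀ
  rw [G.incidence_origin_mul_incidence_leftFace, Matrix.map_zero _ Int.cast_zero] at h
  rw [mem_cycles_iff, Matrix.mulVec_mulVec, ← h, Matrix.zero_mulVec]

variable [NeZero d] [DecidableEq E]

lemma vertexUnitary_eq_shift (v : G.Vertex) :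
    (G.vertexUnitary v : Hilb E d ≃ₗᵢ[ℂ] Hilb E d) =
      shift fun e => ((incidence G.origin v e : ℤ) : ZMod d) :=
  prodX_eq_shift _

lemma faceUnitary_eq_modulate (f : G.Face) :
    (G.faceUnitary f : Hilb E d ≃ₗᵢ[ℂ] Hilb E d) =
      modulate fun e => ((-incidence G.leftFace f e : ℤ) : ZMod d) := by
  rw [faceUnitary, prodZ_eq_modulate]
  congr 1
  ext e
  rw [incidence_apply, neg_sub]
  rfl

/-- The translations fixing `ψ` form a subgroup, hence a `ℤ/d`-submodule, and the coboundaries are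
spanned by the translation vectors of the `a_v`. -/
lemma forall_vertexUnitary_iff (ψ : Hilb E d) :
    (∀ v, G.vertexUnitary v ψ = ψ) ↔ ∀ β ∈ G.dual.boundaries d, ∀ k, ψ (k - β) = ψ k := by
  constructor
  · intro h β hβ
    let stab : AddSubgroup (E → ZMod d) :=
      { carrier := {β | ∀ k, ψ (k - β) = ψ k}
        zero_mem' := fun k => by rw [sub_zero]
        add_mem' := fun {a b} ha hb k => by rw [← sub_sub, hb, ha]
        neg_mem' := fun {a} ha k => by rw [← ha (k - -a)]; simp }
    obtain ⟨c, rfl⟩ := G.mem_dual_boundaries_iff.1 hβ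
    suffices (incidence G.origin)ᵀ.map (Int.cast : ℤ → ZMod d) *ᵥ c ∈
        AddSubgroup.toZModSubmodule d stab from this
    rw [Matrix.mulVec_eq_sum]
    refine Submodule.sum_mem _ fun v _ => ?_
    rw [op_smul_eq_smul]
    refine Submodule.smul_mem (AddSubgroup.toZModSubmodule d stab) _ ?_
    change ∀ k, _
    intro k
    have := congrArg (fun φ : Hilb E d => φ k) (h v)
    rw [vertexUnitary_eq_shift] at this
    simp only [shift_apply] at this
    exact this
  · intro h v
    ext k
    rw [vertexUnitary_eq_shift, shift_apply]
    refine h _ ?_ k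
    refine G.mem_dual_boundaries_iff.2 ⟨Pi.single v 1, ?_⟩
    ext e
    simp

/-- At `k`, each `b_f` acts by a character of the `f`-coordinate of the face matrix applied to `k`.
The character is faithful, so `ψ k ≠ 0` forces all these coordinates to vanish. -/
lemma forall_faceUnitary_iff (ψ : Hilb E d) :
    (∀ f, G.faceUnitary f ψ = ψ) ↔ ∀ k ∉ G.dual.cycles d, ψ k = 0 := by
  have hdot : ∀ (f : G.Face) (k : E → ZMod d),
      (fun e => ((-incidence G.leftFace f e : ℤ) : ZMod d)) ⬝ᵥ k =
        -((incidence G.leftFace).map (Int.cast : ℤ → ZMod d) *ᵥ k) f := by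
    intro f k
    simp [Matrix.mulVec, dotProduct]
  constructor
  · intro h k hk
    by_contra hne
    refine hk (G.mem_dual_cycles_iff.2 ?_)
    ext f
    have := congrArg (fun φ : Hilb E d => φ k) (h f)
    rw [faceUnitary_eq_modulate] at this
    simp only [modulate_apply, hdot] at this
    have h1 := (mul_eq_right₀ hne).1 this
    rw [← AddChar.map_zero_eq_one (ZMod.stdAddChar (N := d))] at h1
    simpa using ZMod.injective_stdAddChar h1
  · intro h f
    ext k
    rw [faceUnitary_eq_modulate, modulate_apply]
    by_cases hk : k ∈ G.dual.cycles d
    · rw [hdot, G.mem_dual_cycles_iff.1 hk]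
      simp
    · rw [h k hk, mul_zero]

/-- Ground states are the functions supported on cocycles and invariant under coboundaries. -/
theorem mem_groundSpace_iff (ψ : Hilb E d) :
    ψ ∈ G.groundSpace d ↔ (∀ k ∉ G.dual.cycles d, ψ k = 0) ∧
      ∀ β ∈ G.dual.boundaries d, ∀ k, ψ (k - β) = ψ k := by
  let U : G.Vertex ⊕ G.Face → (Hilb E d ≃ₗᵢ[ℂ] Hilb E d) :=
    Sum.elim G.vertexUnitary G.faceUnitary
  have hH : G.hamiltonian d = -∑ i, average d (U i) := by
    rw [Fintype.sum_sum_type, neg_add, ← sub_eq_add_neg]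
    rfl
  have hfix : ∀ φ : Hilb E d, (∀ i, U i φ = φ) ↔ (∀ k ∉ G.dual.cycles d, φ k = 0) ∧
      ∀ β ∈ G.dual.boundaries d, ∀ k, φ (k - β) = φ k := by
    intro φ
    rw [Sum.forall, and_comm, ← forall_vertexUnitary_iff, ← forall_faceUnitary_iff]
    rfl
  rw [groundSpace, groundEnergy, hH, mem_eigenspace_neg_sum_average, hfix]
  · rintro (v | f)
    · exact (congrArg (· ^ d) (G.vertexUnitary_eq_shift v)).trans (shift_pow_eq_one _)
    · exact (congrArg (· ^ d) (G.faceUnitary_eq_modulate f)).trans (modulate_pow_eq_one _)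
  · classical
    -- The indicator of the cocycles is a nonzero common fixed vector.
    refine ⟨WithLp.toLp 2 fun k => if k ∈ G.dual.cycles d then 1 else 0, ?_, ?_⟩
    · intro h
      have := congrArg (fun φ : Hilb E d => φ 0) h
      simp at this
    · rw [hfix]
      refine ⟨fun k hk => by simp [hk], fun β hβ k => ?_⟩
      simp [Submodule.sub_mem_iff_left _ (G.dual.boundaries_le_cycles hβ)]

end PolygonDecomposition

/-! ### Weyl operators on functions on `(ℤ/d)^ι` -/

section Weyl

variable {ι : Type*} {d : ℕ}

/-- Translation of functions on `(ℤ/d)^ι`. -/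
def weylX (u : ι → ZMod d) : Module.End ℂ ((ι → ZMod d) → ℂ) :=
  LinearMap.funLeft ℂ ℂ (fun w => w - u)

lemma weylX_apply (u w : ι → ZMod d) (φ : (ι → ZMod d) → ℂ) : weylX u φ w = φ (w - u) := rfl

variable [Fintype ι] [NeZero d]

/-- Multiplication of functions on `(ℤ/d)^ι` by a character. -/
noncomputable def weylZ (y : ι → ZMod d) : Module.End ℂ ((ι → ZMod d) → ℂ) :=
  LinearMap.mulLeft ℂ fun w => ZMod.stdAddChar (y ⬝ᵥ w)

lemma weylZ_apply (y w : ι → ZMod d) (φ : (ι → ZMod d) → ℂ) :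
    weylZ y φ w = ZMod.stdAddChar (y ⬝ᵥ w) * φ w := rfl

variable [DecidableEq ι]

lemma sum_stdAddChar_dotProduct (z : ι → ZMod d) :
    ∑ y : ι → ZMod d, ZMod.stdAddChar (y ⬝ᵥ z) =
      if z = 0 then (Fintype.card (ι → ZMod d) : ℂ) else 0 := by
  let ψ : AddChar (ι → ZMod d) ℂ :=
    { toFun := fun y => ZMod.stdAddChar (y ⬝ᵥ z)
      map_zero_eq_one' := by simp
      map_add_eq_mul' := fun a b => by rw [add_dotProduct, AddChar.map_add_eq_mul] }
  have hψ : ψ = 0 ↔ z = 0 := by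
    constructor
    · intro h
      ext i
      have h1 : ZMod.stdAddChar (Pi.single i 1 ⬝ᵥ z) = (1 : ℂ) :=
        DFunLike.congr_fun h (Pi.single i 1)
      rw [← AddChar.map_zero_eq_one (ZMod.stdAddChar (N := d))] at h1
      simpa using ZMod.injective_stdAddChar h1
    · rintro rfl
      ext y
      change ZMod.stdAddChar (y ⬝ᵥ 0) = (1 : ℂ)
      simp
  have := open scoped Classical in AddChar.sum_eq_ite ψ
  simp only [hψ] at this
  exact this

/-- The Weyl operators span the algebra of all operators. -/
theorem span_weyl_eq_top :
    Submodule.span ℂ {T | ∃ u y : ι → ZMod d, T = weylX u * weylZ y} = ⊤ := by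
  rw [eq_top_iff]
  rintro T -
  have hcard : (Fintype.card (ι → ZMod d) : ℂ) ≠ 0 := Nat.cast_ne_zero.2 Fintype.card_ne_zero
  -- Expansion in matrix units: the weighted sum of `weylZ y` over `y` is the projection to the
  -- point `w`, by Fourier inversion, and translation by `w' - w` moves the value to `w'`.
  have key : T = ∑ w, ∑ w', T (Pi.single w 1) w' • ∑ y : ι → ZMod d,
      ((Fintype.card (ι → ZMod d) : ℂ)⁻¹ * ZMod.stdAddChar (-(y ⬝ᵥ w))) •
        (weylX (w' - w) * weylZ y) := by
    refine LinearMap.ext fun φ => ?_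
    ext v
    have hproj : ∀ w w' : ι → ZMod d, (∑ y : ι → ZMod d,
      ((Fintype.card (ι → ZMod d) : ℂ)⁻¹ * ZMod.stdAddChar (-(y ⬝ᵥ w))) •
        (weylX (w' - w) * weylZ y)) φ v = if v = w' then φ w else 0 := by
      intro w w'
      have h1 : ∀ y : ι → ZMod d, ((Fintype.card (ι → ZMod d) : ℂ)⁻¹ *
          ZMod.stdAddChar (-(y ⬝ᵥ w))) * (ZMod.stdAddChar (y ⬝ᵥ (v - (w' - w))) * φ (v - (w' - w)))
          = ((Fintype.card (ι → ZMod d) : ℂ)⁻¹ * φ (v - (w' - w))) *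
            ZMod.stdAddChar (y ⬝ᵥ (v - w')) := by
        intro y
        have : y ⬝ᵥ (v - w') = -(y ⬝ᵥ w) + y ⬝ᵥ (v - (w' - w)) := by
          simp only [dotProduct_sub]; ring
        rw [this, AddChar.map_add_eq_mul]
        ring
      simp only [LinearMap.sum_apply, LinearMap.smul_apply, Finset.sum_apply, Pi.smul_apply,
        Module.End.mul_apply, weylX_apply, weylZ_apply, smul_eq_mul, h1]
      rw [← Finset.mul_sum, sum_stdAddChar_dotProduct]
      simp only [sub_eq_zero]
      split_ifs with h
      · subst h
        rw [sub_sub_cancel, mul_right_comm, inv_mul_cancel₀ hcard, one_mul]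
      · rw [mul_zero]
    have hT : T φ = ∑ w, φ w • T (Pi.single w 1) := by
      conv_lhs => rw [pi_eq_sum_univ' φ]
      simp [map_sum]
    rw [hT, LinearMap.sum_apply, Finset.sum_apply, Finset.sum_apply]
    refine Finset.sum_congr rfl fun w _ => ?_
    rw [LinearMap.sum_apply, Finset.sum_apply]
    simp only [LinearMap.smul_apply, Pi.smul_apply, hproj]
    simp [mul_comm]
  rw [key]
  refine Submodule.sum_mem _ fun w _ => Submodule.sum_mem _ fun w' _ => Submodule.smul_mem _ _ ?_
  exact Submodule.sum_mem _ fun y _ => Submodule.smul_mem _ _ (Submodule.subset_span ⟨_, _, rfl⟩)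

end Weyl

/-! ### Tensor powers of a matrix algebra -/

section Tensor

variable {ι κ : Type*} [Fintype ι]

/-- The Kronecker product of a family of matrices. -/
noncomputable def piKronecker :
    MultilinearMap ℂ (fun _ : ι => Matrix κ κ ℂ) (Matrix (ι → κ) (ι → κ) ℂ) :=
  (Matrix.ofLinearEquiv ℂ).toLinearMap.compMultilinearMap <|
    MultilinearMap.pi fun a => MultilinearMap.pi fun b =>
      (MultilinearMap.mkPiAlgebra ℂ ι ℂ).compLinearMap fun i =>
        Matrix.entryLinearMap ℂ ℂ (a i) (b i)

lemma piKronecker_apply (M : ι → Matrix κ κ ℂ) (a b : ι → κ) :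
    piKronecker M a b = ∏ i, M i (a i) (b i) := rfl

variable [DecidableEq ι] [Fintype κ] [DecidableEq κ]

theorem nonempty_piTensorProduct_matrix_algEquiv :
    Nonempty ((⨂[ℂ] _ : ι, Matrix κ κ ℂ) ≃ₐ[ℂ] Matrix (ι → κ) (ι → κ) ℂ) := by
  let f : (⨂[ℂ] _ : ι, Matrix κ κ ℂ) →ₐ[ℂ] Matrix (ι → κ) (ι → κ) ℂ :=
    PiTensorProduct.liftAlgHom piKronecker
      (by
        ext a b
        simp [piKronecker_apply, Matrix.one_apply, Finset.prod_ite_zero, funext_iff])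
      (by
        intro M N
        ext a b
        simp only [piKronecker_apply, Pi.mul_apply, Matrix.mul_apply, Finset.prod_univ_sum,
          Fintype.piFinset_univ, Finset.prod_mul_distrib])
  have hf : ∀ M, f (PiTensorProduct.tprod ℂ M) = piKronecker M := fun M => by simp [f]
  have hsurj : Function.Surjective f := by
    rw [← AlgHom.range_eq_top, eq_top_iff]
    rintro M -
    rw [Matrix.matrix_eq_sum_single M]
    refine Subalgebra.sum_mem _ fun a _ => Subalgebra.sum_mem _ fun b _ => ?_
    -- A matrix unit is the Kronecker product of matrix units; surjectivity and equality of
    -- dimensions then give bijectivity.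
    have : Matrix.single a b (M a b) =
        M a b • f (PiTensorProduct.tprod ℂ fun i => Matrix.single (a i) (b i) 1) := by
      rw [hf]
      ext a' b'
      simp only [Matrix.smul_apply, piKronecker_apply, Matrix.single_apply, Finset.prod_ite_zero]
      simp [funext_iff, forall_and]
    rw [this]
    exact Subalgebra.smul_mem _ (f.mem_range_self _) _
  have hrank : Module.finrank ℂ (⨂[ℂ] _ : ι, Matrix κ κ ℂ) =
      Module.finrank ℂ (Matrix (ι → κ) (ι → κ) ℂ) := by
    rw [Module.finrank_eq_card_basis (Basis.piTensorProduct fun _ : ι => Matrix.stdBasis ℂ κ κ),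
      Module.finrank_eq_card_basis (Matrix.stdBasis ℂ (ι → κ) (ι → κ))]
    simp [mul_pow]
  have hinj : Function.Injective f :=
    (LinearMap.injective_iff_surjective_of_finrank_eq_finrank (f := f.toLinearMap) hrank).2 hsurj
  exact ⟨AlgEquiv.ofBijective f ⟨hinj, hsurj⟩⟩

end Tensor

lemma val_nsmul_single {ι : Type*} [DecidableEq ι] {d : ℕ} [NeZero d] (i : ι) (x : ZMod d) :
    x.val • (Pi.single i 1 : ι → ZMod d) = Pi.single i x := by
  rw [← Pi.single_smul, nsmul_one, ZMod.natCast_zmod_val]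

/-! ### Labels, their pairing and dual labellings -/

section Label

variable {g d : ℕ}

/-- The standard pairing of labels. -/
def labelForm (a b : Label g d) : ZMod d := a.1 ⬝ᵥ b.2 + a.2 ⬝ᵥ b.1

lemma labelForm_add_left (a a' b : Label g d) :
    labelForm (a + a') b = labelForm a b + labelForm a' b := by
  simp [labelForm, add_dotProduct]; abel

lemma labelForm_add_right (a b b' : Label g d) :
    labelForm a (b + b') = labelForm a b + labelForm a b' := by
  simp [labelForm, dotProduct_add]; abel

lemma eq_zero_of_labelForm {b : Label g d} (h : ∀ a, labelForm a b = 0) : b = 0 := by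
  refine Prod.ext ?_ ?_ <;> ext i
  · simpa [labelForm, lab₂] using h (lab₂ i)
  · simpa [labelForm, lab₁] using h (lab₁ i)

variable [NeZero d]

/-- The labels `(v_i, 0)` and `(0, v_i)` generate all labels. -/
theorem label_induction {p : Label g d → Prop} (h₁ : ∀ i, p (lab₁ i)) (h₂ : ∀ i, p (lab₂ i))
    (h0 : p 0) (hadd : ∀ a b, p a → p b → p (a + b)) (a : Label g d) : p a := by
  let P : AddSubmonoid (Label g d) :=
    { carrier := {a | p a}, zero_mem' := h0, add_mem' := fun {a b} ha hb => hadd a b ha hb }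
  have key : a = ∑ i, (a.1 i).val • lab₁ i + ∑ i, (a.2 i).val • lab₂ i := by
    refine Prod.ext ?_ ?_ <;>
      simp [lab₁, lab₂, Prod.fst_sum, Prod.snd_sum, val_nsmul_single, Finset.univ_sum_single,
        -nsmul_eq_mul]
  change a ∈ P
  rw [key]
  exact add_mem (sum_mem fun i _ => nsmul_mem (h₁ i) _) (sum_mem fun i _ => nsmul_mem (h₂ i) _)

/-- Every identification of the labels with the standard module has a unique dual one with respect
to the pairing of labels. -/
theorem existsUnique_dual_labelling {ι : Type*} [Fintype ι] [DecidableEq ι]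
    (L : Label g d ≃+ (ι → ZMod d)) :
    ∃! L' : Label g d ≃+ (ι → ZMod d), ∀ a b, L a ⬝ᵥ L' b = labelForm a b := by
  -- Pairing with the `L`-preimages of the unit vectors forces every coordinate of the dual
  -- labelling.
  let θ : Label g d →+ (ι → ZMod d) :=
    { toFun := fun b j => labelForm (L.symm (Pi.single j 1)) b
      map_zero' := by ext j; simp [labelForm]
      map_add' := fun b b' => by ext j; simp [labelForm_add_right] }
  have hθ : ∀ a b, L a ⬝ᵥ θ b = labelForm a b := by
    intro a b
    let ℓ : (ι → ZMod d) →+ ZMod d :=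
      { toFun := fun w => labelForm (L.symm w) b
        map_zero' := by simp [labelForm]
        map_add' := fun w w' => by simp [labelForm_add_left] }
    have h := LinearMap.pi_apply_eq_sum_univ (ℓ.toZModLinearMap d) (L a)
    have h1 : ℓ.toZModLinearMap d (L a) = labelForm a b := by simp [ℓ]
    rw [← h1, h]
    refine Finset.sum_congr rfl fun j _ => ?_
    have h2 : (fun k => if j = k then (1 : ZMod d) else 0) = Pi.single j 1 := by
      ext k; simp [Pi.single_apply, eq_comm]
    rw [h2]
    rfl
  have hinj : Function.Injective θ := by
    rw [injective_iff_map_eq_zero]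
    intro b hb
    refine eq_zero_of_labelForm fun a => ?_
    rw [← hθ, hb, dotProduct_zero]
  -- Injectivity, from nondegeneracy, suffices: `L` shows that the two finite sets have equal size.
  have hbij : Function.Bijective θ :=
    (Fintype.bijective_iff_injective_and_card θ).2 ⟨hinj, Fintype.card_congr L.toEquiv⟩
  refine ⟨AddEquiv.ofBijective θ hbij, hθ, ?_⟩
  intro L' hL'
  ext b j
  have h := (hL' (L.symm (Pi.single j 1)) b).trans (hθ (L.symm (Pi.single j 1)) b).symm
  simpa using h

end Label

/-! ### Number of generators -/

section Rank

/-- The minimal number of generators of a free module over `ℤ/d`. -/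
theorem pow_rank_eq_pow {d n : ℕ} [NeZero d] {H : Type*} [AddCommGroup H] [Module (ZMod d) H]
    [AddGroup.FG H] (α : H ≃ₗ[ZMod d] (Fin n → ZMod d)) : d ^ AddGroup.rank H = d ^ n := by
  classical
  have hd : 0 < d := NeZero.pos d
  -- Only powers of `d` can be compared: for `d = 1` the module is zero and has rank `0` whatever
  -- `n` is.
  apply le_antisymm
  · refine Nat.pow_le_pow_right hd ?_
    let S : Finset H := Finset.univ.image fun i => α.symm (Pi.single i 1)
    refine (AddGroup.rank_le (S := S) ?_).trans (Finset.card_image_le.trans (by simp))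
    rw [eq_top_iff]
    rintro x -
    have hx : x = ∑ i, (α x i).val • α.symm (Pi.single i 1) := by
      apply α.injective
      simp [map_sum, val_nsmul_single, Finset.univ_sum_single, -nsmul_eq_mul]
    rw [hx]
    refine sum_mem fun i _ => nsmul_mem (AddSubgroup.subset_closure ?_) _
    simp [S]
  · obtain ⟨S, hS, hgen⟩ := AddGroup.rank_spec H
    rw [← hS]
    let f : (S → ZMod d) →ₗ[ZMod d] H := Fintype.linearCombination (ZMod d) fun x : S => (x : H)
    have hf : Function.Surjective f := by
      rw [← LinearMap.range_eq_top, Fintype.range_linearCombination, eq_top_iff]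
      rintro x -
      have hx : x ∈ AddSubgroup.closure (S : Set H) := hgen ▸ AddSubgroup.mem_top x
      refine (AddSubgroup.closure_le
        (K := (Submodule.span (ZMod d) (Set.range fun x : S => (x : H))).toAddSubgroup)).2 ?_ hx
      intro y hy
      exact Submodule.subset_span ⟨⟨y, hy⟩, rfl⟩
    -- A generating set of `r` elements makes the module a quotient of `(ℤ/d)^r`, so `d ^ n ≤ d ^
    -- r`.
    have h := Nat.card_le_card_of_surjective (α ∘ f) (α.surjective.comp hf)
    simpa [Nat.card_eq_fintype_card, ZMod.card] using h

end Rank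

/-! ### Abstract Weyl models -/

/-- The algebra of restrictions to a subspace consists of all operators on it. -/
lemma algebraOn_eq_top {H : Type*} [AddCommGroup H] [Module ℂ H] (K : Submodule ℂ H) :
    algebraOn K = ⊤ := by
  rw [eq_top_iff]
  rintro T -
  -- A linear retraction `p` onto `K` extends any operator on `K` to the whole space.
  obtain ⟨p, hp⟩ := LinearMap.exists_leftInverse_of_injective K.subtype (Submodule.ker_subtype K)
  refine ⟨⟨K.subtype ∘ₗ T ∘ₗ p, fun ψ _ => (T (p ψ)).2⟩, ?_⟩
  refine LinearMap.ext fun ψ => Subtype.ext ?_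
  have : p ψ = ψ := LinearMap.congr_fun hp ψ
  change ((T (p ψ) : K) : H) = T ψ
  rw [this]

lemma gcomm_map_eq_one {A U : Type*} [AddCommGroup A] [Group U] (ρ : Multiplicative A →* U)
    (a b : A) : gcomm (ρ (.ofAdd a)) (ρ (.ofAdd b)) = 1 := by
  rw [gcomm, ← map_mul, mul_comm, map_mul]
  group

/-- Unitary representations of two groups that become, in suitable coordinates, the
multiplications by characters and the translations of functions on `(ℤ/d)^n`. -/
structure WeylModel (S : Type*) [NormedAddCommGroup S] [InnerProductSpace ℂ S] (H H' : Type*)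
    [AddCommGroup H] [AddCommGroup H'] (n d : ℕ) [NeZero d] where
  π : Multiplicative H →* (S ≃ₗᵢ[ℂ] S)
  π' : Multiplicative H' →* (S ≃ₗᵢ[ℂ] S)
  α : H ≃+ (Fin n → ZMod d)
  β : H' ≃+ (Fin n → ZMod d)
  T : S ≃ₗ[ℂ] ((Fin n → ZMod d) → ℂ)
  T_π : ∀ c ψ, T (π (.ofAdd c) ψ) = weylZ (α c) (T ψ)
  T_π' : ∀ c ψ, T (π' (.ofAdd c) ψ) = weylX (β c) (T ψ)

namespace WeylModel

variable {S : Type*} [NormedAddCommGroup S] [InnerProductSpace ℂ S] {H H' : Type*}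
    [AddCommGroup H] [AddCommGroup H'] {n d : ℕ} [NeZero d] (M : WeylModel S H H' n d)

theorem finrank_eq (M : WeylModel S H H' n d) : Module.finrank ℂ S = d ^ n := by
  rw [M.T.finrank_eq]
  simp [ZMod.card]

lemma nontrivial (M : WeylModel S H H' n d) : Nontrivial S := M.T.symm.injective.nontrivial

lemma span_eq_top :
    Submodule.span ℂ {O : Module.End ℂ S | ∃ c' c, O = toEnd (M.π' (.ofAdd c')) *
      toEnd (M.π (.ofAdd c))} = ⊤ := by
  have h := congrArg (Submodule.map M.T.symm.conj.toLinearMap)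
    (span_weyl_eq_top (ι := Fin n) (d := d))
  rw [Submodule.map_span, Submodule.map_top, LinearEquiv.range] at h
  rw [eq_top_iff, ← h]
  refine Submodule.span_mono ?_
  rintro _ ⟨_, ⟨u, y, rfl⟩, rfl⟩
  refine ⟨M.β.symm u, M.α.symm y, LinearMap.ext fun ψ => ?_⟩
  apply M.T.injective
  simp [LinearEquiv.conj_apply, M.T_π, M.T_π']

/-- The character is evaluated at `w` on one side and at the translated point `w - β c'` on the
other; the quotient is a constant phase. -/
lemma mul_comm_apply (c : H) (c' : H') (ψ : S) :
    M.π (.ofAdd c) (M.π' (.ofAdd c') ψ) =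
      (ZMod.stdAddChar (M.α c ⬝ᵥ M.β c') : ℂ) • M.π' (.ofAdd c') (M.π (.ofAdd c) ψ) := by
  apply M.T.injective
  ext w
  rw [map_smul, Pi.smul_apply, M.T_π, M.T_π', M.T_π', M.T_π]
  simp only [weylZ_apply, weylX_apply, dotProduct_sub, smul_eq_mul]
  rw [← mul_assoc, ← AddChar.map_add_eq_mul, add_sub_cancel]

lemma toEnd_gcomm (c : H) (c' : H') :
    toEnd (gcomm (M.π (.ofAdd c)) (M.π' (.ofAdd c'))) =
      (ZMod.stdAddChar (M.α c ⬝ᵥ M.β c') : ℂ) • (1 : Module.End ℂ S) := by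
  refine LinearMap.ext fun ψ => ?_
  set A := M.π (.ofAdd c)
  set B := M.π' (.ofAdd c')
  have h := M.mul_comm_apply c c' (A⁻¹ (B⁻¹ ψ))
  change A (B (A⁻¹ (B⁻¹ ψ))) = _
  rw [h]
  change _ • (B * (A * A⁻¹) * B⁻¹) ψ = _
  rw [mul_inv_cancel, mul_one, mul_inv_cancel]
  rfl

/-- The space is nonzero and the character faithful, so the commutator determines the pairing. -/
lemma toEnd_gcomm_eq_smul_iff (c : H) (c' : H') (z : ZMod d) :
    toEnd (gcomm (M.π (.ofAdd c)) (M.π' (.ofAdd c'))) =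
      (ZMod.stdAddChar z : ℂ) • (1 : Module.End ℂ S) ↔ M.α c ⬝ᵥ M.β c' = z := by
  have := M.nontrivial
  rw [toEnd_gcomm]
  refine ⟨fun h => ?_, fun h => by rw [h]⟩
  exact ZMod.injective_stdAddChar (smul_left_injective ℂ one_ne_zero h)

lemma gcomm_eq_one_iff (c : H) (c' : H') :
    gcomm (M.π (.ofAdd c)) (M.π' (.ofAdd c')) = 1 ↔ M.α c ⬝ᵥ M.β c' = 0 := by
  rw [← M.toEnd_gcomm_eq_smul_iff, AddChar.map_zero_eq_one, one_smul]
  refine ⟨fun h => by rw [h]; rfl, fun h => ?_⟩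
  ext ψ
  exact LinearMap.congr_fun h ψ

/-- The commutation relations hold exactly if the labellings are dual to each other. -/
theorem weylRelations_iff {g : ℕ} (Φ : Label g d ≃+ H) (Φ' : Label g d ≃+ H') :
    WeylRelations (fun a => M.π (.ofAdd (Φ a))) (fun a => M.π' (.ofAdd (Φ' a))) ↔
      ∀ a b, M.α (Φ a) ⬝ᵥ M.β (Φ' b) = labelForm a b := by
  constructor
  · intro h a b
    -- Both sides are biadditive, so it suffices to compare them on generators, where each case is
    -- one of the relations.
    induction a using label_induction with
    | h0 => simp [labelForm]
    | hadd a a' ha ha' => rw [map_add, map_add, add_dotProduct, ha, ha', labelForm_add_left]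
    | h₁ i =>
      induction b using label_induction with
      | h0 => simp [labelForm]
      | hadd b b' hb hb' => rw [map_add, map_add, dotProduct_add, hb, hb', labelForm_add_right]
      | h₁ j => rw [(M.gcomm_eq_one_iff _ _).1 (h.comm₁₁ i j)]; simp [labelForm, lab₁]
      | h₂ j =>
        rcases eq_or_ne i j with rfl | hij
        · have h1 := h.comm₁₂ i
          rw [omega_eq_stdAddChar, M.toEnd_gcomm_eq_smul_iff] at h1
          rw [h1]; simp [labelForm, lab₁, lab₂]
        · rw [(M.gcomm_eq_one_iff _ _).1 (h.comm₁₂_ne i j hij)]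
          simp [labelForm, lab₁, lab₂, hij]
    | h₂ i =>
      induction b using label_induction with
      | h0 => simp [labelForm]
      | hadd b b' hb hb' => rw [map_add, map_add, dotProduct_add, hb, hb', labelForm_add_right]
      | h₂ j => rw [(M.gcomm_eq_one_iff _ _).1 (h.comm₂₂ i j)]; simp [labelForm, lab₂]
      | h₁ j =>
        rcases eq_or_ne i j with rfl | hij
        · have h1 := h.comm₂₁ i
          rw [omega_eq_stdAddChar, M.toEnd_gcomm_eq_smul_iff] at h1
          rw [h1]; simp [labelForm, lab₁, lab₂]
        · rw [(M.gcomm_eq_one_iff _ _).1 (h.comm₂₁_ne i j hij)]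
          simp [labelForm, lab₁, lab₂, hij]
  · intro h
    refine ⟨fun i => ?_, fun i => ?_, fun i j hij => ?_, fun i j hij => ?_, fun i j => ?_,
      fun i j => ?_, fun i j => ⟨gcomm_map_eq_one M.π _ _, gcomm_map_eq_one M.π _ _,
        gcomm_map_eq_one M.π _ _⟩,
      fun i j => ⟨gcomm_map_eq_one M.π' _ _, gcomm_map_eq_one M.π' _ _,
        gcomm_map_eq_one M.π' _ _⟩⟩
    · rw [omega_eq_stdAddChar, M.toEnd_gcomm_eq_smul_iff, h]; simp [labelForm, lab₁, lab₂]
    · rw [omega_eq_stdAddChar, M.toEnd_gcomm_eq_smul_iff, h]; simp [labelForm, lab₁, lab₂]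
    · rw [M.gcomm_eq_one_iff, h]; simp [labelForm, lab₁, lab₂, hij]
    · rw [M.gcomm_eq_one_iff, h]; simp [labelForm, lab₁, lab₂, hij]
    · rw [M.gcomm_eq_one_iff, h]; simp [labelForm, lab₁]
    · rw [M.gcomm_eq_one_iff, h]; simp [labelForm, lab₂]

theorem existsUnique_weylRelations {g : ℕ} (Φ : Label g d ≃+ H) :
    ∃! Φ' : Label g d ≃+ H',
      WeylRelations (fun a => M.π (.ofAdd (Φ a))) (fun a => M.π' (.ofAdd (Φ' a))) := by
  obtain ⟨L', hL', huniq⟩ := existsUnique_dual_labelling (Φ.trans M.α)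
  refine ⟨L'.trans M.β.symm, (M.weylRelations_iff _ _).2 fun a b => ?_, fun Φ' hΦ' => ?_⟩
  · simpa using hL' a b
  · have := huniq (Φ'.trans M.β) ((M.weylRelations_iff _ _).1 hΦ')
    ext b
    rw [← this]
    simp

/-- The generators yield all `π` and `π'` operators, and products of these span. No duality between
`Φ` and `Φ'` is involved. -/
theorem adjoin_eq_top {g : ℕ} (Φ : Label g d ≃+ H) (Φ' : Label g d ≃+ H') :
    Algebra.adjoin ℂ (⋃ i : Fin g,
      {toEnd (M.π' (.ofAdd (Φ' (lab₁ i)))), toEnd (M.π' (.ofAdd (Φ' (lab₂ i)))),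
        toEnd (M.π (.ofAdd (Φ (lab₁ i)))), toEnd (M.π (.ofAdd (Φ (lab₂ i))))} :
      Set (Module.End ℂ S)) = ⊤ := by
  set 𝒜 := Algebra.adjoin ℂ (⋃ i : Fin g,
      {toEnd (M.π' (.ofAdd (Φ' (lab₁ i)))), toEnd (M.π' (.ofAdd (Φ' (lab₂ i)))),
        toEnd (M.π (.ofAdd (Φ (lab₁ i)))), toEnd (M.π (.ofAdd (Φ (lab₂ i))))} :
      Set (Module.End ℂ S)) with h𝒜
  have hmem : ∀ i : Fin g, ∀ O ∈ ({toEnd (M.π' (.ofAdd (Φ' (lab₁ i)))),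
      toEnd (M.π' (.ofAdd (Φ' (lab₂ i)))), toEnd (M.π (.ofAdd (Φ (lab₁ i)))),
      toEnd (M.π (.ofAdd (Φ (lab₂ i))))} : Set (Module.End ℂ S)), O ∈ 𝒜 :=
    fun i O hO => Algebra.subset_adjoin (Set.mem_iUnion.2 ⟨i, hO⟩)
  have hZ : ∀ a : Label g d, toEnd (M.π (.ofAdd (Φ a))) ∈ 𝒜 := by
    intro a
    induction a using label_induction with
    | h₁ i => exact hmem i _ (by simp)
    | h₂ i => exact hmem i _ (by simp)
    | h0 => rw [map_zero, ofAdd_zero, map_one]; exact one_mem 𝒜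
    | hadd a b ha hb => rw [map_add, ofAdd_add, map_mul]; exact mul_mem ha hb
  have hX : ∀ a : Label g d, toEnd (M.π' (.ofAdd (Φ' a))) ∈ 𝒜 := by
    intro a
    induction a using label_induction with
    | h₁ i => exact hmem i _ (by simp)
    | h₂ i => exact hmem i _ (by simp)
    | h0 => rw [map_zero, ofAdd_zero, map_one]; exact one_mem 𝒜
    | hadd a b ha hb => rw [map_add, ofAdd_add, map_mul]; exact mul_mem ha hb
  rw [← Algebra.toSubmodule_eq_top, eq_top_iff, ← M.span_eq_top, Submodule.span_le]
  rintro _ ⟨c', c, rfl⟩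
  have h1 := hX (Φ'.symm c')
  have h2 := hZ (Φ.symm c)
  rw [AddEquiv.apply_symm_apply] at h1 h2
  exact 𝒜.mul_mem h1 h2

theorem nonempty_algEquiv (M : WeylModel S H H' n d) :
    Nonempty (Module.End ℂ S ≃ₐ[ℂ] ⨂[ℂ] _ : Fin n, Matrix (Fin d) (Fin d) ℂ) := by
  obtain ⟨f⟩ := nonempty_piTensorProduct_matrix_algEquiv (ι := Fin n) (κ := Fin d)
  let e : (Fin n → ZMod d) ≃ (Fin n → Fin d) :=
    Equiv.piCongrRight fun _ => (ZMod.finEquiv d).toEquiv.symm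
  exact ⟨((LinearEquiv.conjAlgEquiv ℂ M.T).trans LinearMap.toMatrixAlgEquiv').trans
    ((Matrix.reindexAlgEquiv ℂ ℂ e).trans f.symm)⟩

/-- Some rank-one operator takes `ψ` to any prescribed `φ`; expanding it in Weyl operators and
evaluating at `ψ` expresses `φ`. -/
theorem span_apply_eq_top {ψ : S} (hψ : ψ ≠ 0) :
    Submodule.span ℂ {φ : S | ∃ c' c, φ = M.π' (.ofAdd c') (M.π (.ofAdd c) ψ)} = ⊤ := by
  rw [eq_top_iff]
  rintro φ -
  obtain ⟨f, hf⟩ := SeparatingDual.exists_eq_one (R := ℂ) hψ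
  let O : Module.End ℂ S := f.toLinearMap.smulRight φ
  have hO : O ∈ Submodule.span ℂ {O : Module.End ℂ S | ∃ c' c, O = toEnd (M.π' (.ofAdd c')) *
      toEnd (M.π (.ofAdd c))} := M.span_eq_top ▸ Submodule.mem_top
  have h := Submodule.mem_map_of_mem (f := LinearMap.applyₗ (R := ℂ) ψ) hO
  rw [Submodule.map_span] at h
  have hφ : LinearMap.applyₗ (R := ℂ) ψ O = φ := by simp [O, hf]
  rw [hφ] at h
  refine Submodule.span_mono ?_ h
  rintro _ ⟨_, ⟨c', c, rfl⟩, rfl⟩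
  exact ⟨c', c, rfl⟩

end WeylModel

/-! ### Homology acting on the ground space -/

/-- A quotient of submodules is identified with `W` by a map with a section modulo the smaller
submodule. -/
noncomputable def quotientEquivOfSection {R M W : Type*} [CommRing R] [AddCommGroup M] [Module R M]
    [AddCommGroup W] [Module R W] (Z P : Submodule R M) (L : M →ₗ[R] W) (s : W →ₗ[R] M)
    (hL : ∀ γ ∈ P, L γ = 0) (hs : ∀ w, s w ∈ Z) (hLs : ∀ w, L (s w) = w)
    (h : ∀ γ ∈ Z, γ - s (L γ) ∈ P) : (Z ⧸ P.submoduleOf Z) ≃ₗ[R] W :=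
  LinearEquiv.ofBijective
    ((P.submoduleOf Z).liftQ (L ∘ₗ Z.subtype) fun γ hγ => hL γ hγ) <| by
      constructor
      · rw [injective_iff_map_eq_zero]
        intro c
        obtain ⟨γ, rfl⟩ := Submodule.Quotient.mk_surjective _ c
        intro hc
        have hc' : L γ = 0 := hc
        rw [Submodule.Quotient.mk_eq_zero]
        have := h γ γ.2
        rw [hc', map_zero, sub_zero] at this
        exact this
      · intro w
        exact ⟨Submodule.Quotient.mk ⟨s w, hs w⟩, hLs w⟩

/-- The restriction of a unitary representation to an invariant subspace. -/
def restrictRep {Γ K : Type*} [Group Γ] [SeminormedAddCommGroup K] [Module ℂ K]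
    (ρ : Γ →* (K ≃ₗᵢ[ℂ] K)) (S : Submodule ℂ K) (h : ∀ x, ∀ ψ ∈ S, ρ x ψ ∈ S) :
    Γ →* (S ≃ₗᵢ[ℂ] S) where
  toFun x :=
    { toFun := fun ψ => ⟨ρ x ψ, h x ψ ψ.2⟩
      invFun := fun ψ => ⟨ρ x⁻¹ ψ, h x⁻¹ ψ ψ.2⟩
      map_add' := fun _ _ => Subtype.ext (map_add _ _ _)
      map_smul' := fun _ _ => Subtype.ext (map_smul _ _ _)
      left_inv := fun ψ => Subtype.ext (by
        change (ρ x⁻¹ * ρ x) (ψ : K) = ψ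
        rw [← map_mul, inv_mul_cancel, map_one]; rfl)
      right_inv := fun ψ => Subtype.ext (by
        change (ρ x * ρ x⁻¹) (ψ : K) = ψ
        rw [← map_mul, mul_inv_cancel, map_one]; rfl)
      norm_map' := fun ψ => (ρ x).norm_map ψ }
  map_one' := by
    ext ψ
    change ρ 1 (ψ : K) = ψ
    rw [map_one]; rfl
  map_mul' x y := by
    ext ψ
    change ρ (x * y) (ψ : K) = ρ x (ρ y ψ)
    rw [map_mul]; rfl

/-- A representation of a module that is trivial on a submodule descends to the quotient. -/
def liftRep {R M U : Type*} [Ring R] [AddCommGroup M] [Module R M] [Group U] (P : Submodule R M)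
    (ρ : Multiplicative M →* U) (h : ∀ γ ∈ P, ρ (.ofAdd γ) = 1) : Multiplicative (M ⧸ P) →* U :=
  AddMonoidHom.toMultiplicativeLeft
    (QuotientAddGroup.lift P.toAddSubgroup (MonoidHom.toAdditiveRight ρ) fun γ hγ => h γ hγ)

namespace HomologyFrame

variable {E : Type*} [Fintype E] {G : PolygonDecomposition E} {n d : ℕ} (F : HomologyFrame G n d)

lemma transpose_B_mulVec_transpose_A (w : Fin n → ZMod d) : F.Bᵀ *ᵥ (F.Aᵀ *ᵥ w) = w := by
  rw [Matrix.mulVec_mulVec, ← Matrix.transpose_mul, F.A_mul_B, Matrix.transpose_one,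
    Matrix.one_mulVec]

/-- Coordinates on homology. -/
noncomputable def homologyEquiv : G.H₁ d ≃ₗ[ZMod d] (Fin n → ZMod d) :=
  quotientEquivOfSection _ _ F.A.mulVecLin F.B.mulVecLin F.A_boundary F.B_mem
    (fun w => by simp [Matrix.mulVec_mulVec, F.A_mul_B]) F.sub_mem

/-- Coordinates on cohomology. -/
noncomputable def cohomologyEquiv : G.dual.H₁ d ≃ₗ[ZMod d] (Fin n → ZMod d) :=
  quotientEquivOfSection _ _ F.Bᵀ.mulVecLin F.Aᵀ.mulVecLin F.B_boundary F.A_mem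
    F.transpose_B_mulVec_transpose_A F.sub_mem_dual

lemma dotProduct_eq_zero_of_mem_dual_boundaries (F : HomologyFrame G n d) {γ β : E → ZMod d}
    (hγ : γ ∈ G.cycles d)
    (hβ : β ∈ G.dual.boundaries d) : γ ⬝ᵥ β = 0 := by
  rw [F.pairing γ hγ β (G.dual.boundaries_le_cycles hβ), F.B_boundary β hβ, dotProduct_zero]

lemma dotProduct_eq_zero_of_mem_boundaries (F : HomologyFrame G n d) {γ β : E → ZMod d}
    (hγ : γ ∈ G.boundaries d)
    (hβ : β ∈ G.dual.cycles d) : γ ⬝ᵥ β = 0 := by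
  rw [F.pairing γ (G.boundaries_le_cycles hγ) β hβ, F.A_boundary γ hγ, zero_dotProduct]

variable [NeZero d] [DecidableEq E]

/-- A character never enlarges the support, and that of a cycle is constant along coboundaries. -/
lemma modulate_mem (F : HomologyFrame G n d) {γ : E → ZMod d} (hγ : γ ∈ G.cycles d)
    {ψ : Hilb E d}
    (hψ : ψ ∈ G.groundSpace d) : modulate γ ψ ∈ G.groundSpace d := by
  rw [G.mem_groundSpace_iff] at hψ ⊢
  refine ⟨fun k hk => by rw [modulate_apply, hψ.1 k hk, mul_zero], fun β hβ k => ?_⟩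
  rw [modulate_apply, modulate_apply, hψ.2 β hβ, dotProduct_sub,
    F.dotProduct_eq_zero_of_mem_dual_boundaries hγ hβ, sub_zero]

lemma modulate_eq_self (F : HomologyFrame G n d) {γ : E → ZMod d}
    (hγ : γ ∈ G.boundaries d) {ψ : Hilb E d}
    (hψ : ψ ∈ G.groundSpace d) : modulate γ ψ = ψ := by
  rw [G.mem_groundSpace_iff] at hψ
  ext k
  rw [modulate_apply]
  by_cases hk : k ∈ G.dual.cycles d
  · rw [F.dotProduct_eq_zero_of_mem_boundaries hγ hk, AddChar.map_zero_eq_one, one_mul]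
  · rw [hψ.1 k hk, mul_zero]

end HomologyFrame

namespace PolygonDecomposition

variable {E : Type*} [Fintype E] [DecidableEq E] (G : PolygonDecomposition E) {d : ℕ} [NeZero d]

lemma shift_mem {γ : E → ZMod d} (hγ : γ ∈ G.dual.cycles d) {ψ : Hilb E d}
    (hψ : ψ ∈ G.groundSpace d) : shift γ ψ ∈ G.groundSpace d := by
  rw [G.mem_groundSpace_iff] at hψ ⊢
  refine ⟨fun k hk => ?_, fun β hβ k => ?_⟩
  · rw [shift_apply]
    exact hψ.1 _ fun h => hk ((Submodule.sub_mem_iff_left _ hγ).1 h)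
  · rw [shift_apply, shift_apply, sub_right_comm, hψ.2 β hβ]

lemma shift_eq_self {γ : E → ZMod d} (hγ : γ ∈ G.dual.boundaries d) {ψ : Hilb E d}
    (hψ : ψ ∈ G.groundSpace d) : shift γ ψ = ψ := by
  rw [G.mem_groundSpace_iff] at hψ
  ext k
  rw [shift_apply, hψ.2 γ hγ]

end PolygonDecomposition

namespace HomologyFrame

variable {E : Type*} [Fintype E] [DecidableEq E] {G : PolygonDecomposition E} {n d : ℕ} [NeZero d]
  (F : HomologyFrame G n d)

open scoped Classical in
/-- Ground states as functions of the cohomology coordinates. -/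
noncomputable def groundEquiv : G.groundSpace d ≃ₗ[ℂ] ((Fin n → ZMod d) → ℂ) where
  toFun ψ w := (ψ : Hilb E d) (F.Aᵀ *ᵥ w)
  map_add' _ _ := rfl
  map_smul' _ _ := rfl
  invFun φ := ⟨WithLp.toLp 2 fun k => if k ∈ G.dual.cycles d then φ (F.Bᵀ *ᵥ k) else 0, by
    rw [G.mem_groundSpace_iff]
    refine ⟨fun k hk => by simp [hk], fun β hβ k => ?_⟩
    simp [Submodule.sub_mem_iff_left _ (G.dual.boundaries_le_cycles hβ), Matrix.mulVec_sub,
      F.B_boundary β hβ]⟩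
  left_inv ψ := by
    have hψ := (G.mem_groundSpace_iff _).1 ψ.2
    ext k
    by_cases hk : k ∈ G.dual.cycles d
    -- The cocycle `k` differs from its representative `Aᵀ *ᵥ (Bᵀ *ᵥ k)` by a coboundary, which `ψ`
    -- does not see.
    · have := hψ.2 _ (F.sub_mem_dual k hk) k
      rw [sub_sub_cancel] at this
      simpa [hk] using this
    · simpa [hk] using (hψ.1 k hk).symm
  right_inv φ := by
    ext w
    simp [F.A_mem w, F.transpose_B_mulVec_transpose_A]

/-- The representations of homology and cohomology on the ground space. -/
noncomputable def weylModel :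
    WeylModel (G.groundSpace d) (G.H₁ d) (G.dual.H₁ d) n d where
  π := liftRep _ (restrictRep (modulateHom.comp (AddMonoidHom.toMultiplicative
      (G.cycles d).subtype.toAddMonoidHom)) (G.groundSpace d)
      fun γ _ hψ => F.modulate_mem γ.toAdd.2 hψ) fun γ hγ => by
    ext1 ψ
    exact Subtype.ext (F.modulate_eq_self hγ ψ.2)
  π' := liftRep _ (restrictRep (shiftHom.comp (AddMonoidHom.toMultiplicative
      (G.dual.cycles d).subtype.toAddMonoidHom)) (G.groundSpace d)
      fun γ _ hψ => G.shift_mem γ.toAdd.2 hψ) fun γ hγ => by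
    ext1 ψ
    exact Subtype.ext (G.shift_eq_self hγ ψ.2)
  α := F.homologyEquiv.toAddEquiv
  β := F.cohomologyEquiv.toAddEquiv
  T := F.groundEquiv
  T_π c ψ := by
    obtain ⟨γ, rfl⟩ := Submodule.Quotient.mk_surjective _ c
    ext w
    change modulate (γ : E → ZMod d) (ψ : Hilb E d) (F.Aᵀ *ᵥ w) =
      ZMod.stdAddChar ((F.A *ᵥ (γ : E → ZMod d)) ⬝ᵥ w) * (ψ : Hilb E d) (F.Aᵀ *ᵥ w)
    rw [modulate_apply, F.pairing γ γ.2 _ (F.A_mem w), F.transpose_B_mulVec_transpose_A]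
  T_π' c ψ := by
    obtain ⟨γ, rfl⟩ := Submodule.Quotient.mk_surjective _ c
    have hψ := (G.mem_groundSpace_iff _).1 ψ.2
    ext w
    change shift (γ : E → ZMod d) (ψ : Hilb E d) (F.Aᵀ *ᵥ w) =
      (ψ : Hilb E d) (F.Aᵀ *ᵥ (w - F.Bᵀ *ᵥ (γ : E → ZMod d)))
    -- The two arguments of `ψ` differ by the coboundary `γ - Aᵀ *ᵥ (Bᵀ *ᵥ γ)`.
    rw [shift_apply, ← hψ.2 _ (F.sub_mem_dual γ γ.2) (F.Aᵀ *ᵥ (w - F.Bᵀ *ᵥ (γ : E → ZMod d))),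
      Matrix.mulVec_sub]
    refine congrArg (ψ : Hilb E d).ofLp ?_
    abel

lemma weylModel_π_apply (γ : G.cycles d) (ψ : G.groundSpace d) :
    (F.weylModel.π (.ofAdd (G.homologyClass d γ)) ψ : Hilb E d) =
      stringZ (γ : E → ZMod d) ψ := by
  change modulate (γ : E → ZMod d) (ψ : Hilb E d) = _
  ext k
  rw [modulate_apply, stringZ_apply]

lemma weylModel_π'_apply (γ : G.dual.cycles d) (ψ : G.groundSpace d) :
    (F.weylModel.π' (.ofAdd (G.dual.homologyClass d γ)) ψ : Hilb E d) =
      stringX (γ : E → ZMod d) ψ := by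
  change shift (γ : E → ZMod d) (ψ : Hilb E d) = _
  ext k
  rw [shift_apply, stringX_apply]

end HomologyFrame

/-- Pairs of vectors of length `g` are vectors of length `2 * g`. -/
def labelEquiv (g d : ℕ) : Label g d ≃+ (Fin (2 * g) → ZMod d) :=
  ((LinearEquiv.sumArrowLequivProdArrow (Fin g) (Fin g) (ZMod d) (ZMod d)).symm.trans
    (LinearEquiv.funCongrLeft (ZMod d) (ZMod d)
      ((finCongr (two_mul g)).trans finSumFinEquiv.symm))).toAddEquiv

lemma map_ofAdd_pow_eq_one {d : ℕ} {A U : Type*} [AddCommGroup A] [Module (ZMod d) A] [Group U]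
    (ρ : Multiplicative A →* U) (a : A) : ρ (.ofAdd a) ^ d = 1 := by
  rw [← map_pow, ← ofAdd_nsmul, ← Nat.cast_smul_eq_nsmul (ZMod d), ZMod.natCast_self, zero_smul,
    ofAdd_zero, map_one]

end KitaevModel

/-! ### The main theorem -/

theorem mainTheorem1 {E : Type*} [Fintype E] [DecidableEq E] [Nonempty E]
    (G : PolygonDecomposition E) (g : ℕ) (hg : G.HasGenus g) (d : ℕ) [NeZero d] :
    ∃ (π : Multiplicative (G.H₁ d) →* (G.groundSpace d ≃ₗᵢ[ℂ] G.groundSpace d))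
      (π' : Multiplicative (G.dual.H₁ d) →* (G.groundSpace d ≃ₗᵢ[ℂ] G.groundSpace d)),
      -- (i) the representations of homology and of cohomology (the homology of the dual)
      (∀ (γ : G.cycles d) (ψ : G.groundSpace d),
        (π (.ofAdd (G.homologyClass d γ)) ψ : Hilb E d) = stringZ (γ : E → ZMod d) ψ) ∧
      (∀ (γ : G.dual.cycles d) (ψ : G.groundSpace d),
        (π' (.ofAdd (G.dual.homologyClass d γ)) ψ : Hilb E d) = stringX (γ : E → ZMod d) ψ) ∧
      -- (ii) labellings of the (co)homology classes, generators and relations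
      Nonempty (Label g d ≃+ G.H₁ d) ∧
      (∀ Φ : Label g d ≃+ G.H₁ d, ∃! Φ' : Label g d ≃+ G.dual.H₁ d,
        WeylRelations (fun a => π (.ofAdd (Φ a))) (fun a => π' (.ofAdd (Φ' a)))) ∧
      (∀ (Φ : Label g d ≃+ G.H₁ d) (Φ' : Label g d ≃+ G.dual.H₁ d),
        Algebra.adjoin ℂ (⋃ i : Fin g,
          {toEnd (π' (.ofAdd (Φ' (lab₁ i)))), toEnd (π' (.ofAdd (Φ' (lab₂ i)))),
            toEnd (π (.ofAdd (Φ (lab₁ i)))), toEnd (π (.ofAdd (Φ (lab₂ i))))} : Set (Module.End ℂ (G.groundSpace d))) =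
          algebraOn (G.groundSpace d) ∧
        ∀ a : Label g d, π' (.ofAdd (Φ' a)) ^ d = 1 ∧ π (.ofAdd (Φ a)) ^ d = 1) ∧
      Nonempty (algebraOn (G.groundSpace d) ≃ₐ[ℂ]
        ⨂[ℂ] _ : Fin (2 * g), Matrix (Fin d) (Fin d) ℂ) ∧
      -- (iii) the degeneracy
      Module.finrank ℂ (G.groundSpace d) = d ^ G.betti₁ d ∧
      Module.finrank ℂ (G.groundSpace d) = d ^ (2 * g) ∧
      -- (iv) cyclicity
      ∀ Ψ ∈ G.groundSpace d, Ψ ≠ 0 →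
        Submodule.span ℂ {φ : Hilb E d | ∃ τ' ∈ G.dual.cycles d, ∃ τ ∈ G.cycles d,
          φ = stringX τ' (stringZ τ Ψ)} = G.groundSpace d := by
  obtain ⟨F⟩ := G.exists_homologyFrame hg d
  let M := F.weylModel
  refine ⟨M.π, M.π', F.weylModel_π_apply, F.weylModel_π'_apply,
    ⟨(labelEquiv g d).trans M.α.symm⟩, fun Φ => M.existsUnique_weylRelations Φ,
    fun Φ Φ' => ⟨(M.adjoin_eq_top Φ Φ').trans (algebraOn_eq_top _).symm,
      fun a => ⟨map_ofAdd_pow_eq_one _ _, map_ofAdd_pow_eq_one _ _⟩⟩, ?_,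
    M.finrank_eq.trans (pow_rank_eq_pow F.homologyEquiv).symm, M.finrank_eq, ?_⟩
  · obtain ⟨f⟩ := M.nonempty_algEquiv
    exact ⟨(Subalgebra.equivOfEq _ _ (algebraOn_eq_top _)).trans (Subalgebra.topEquiv.trans f)⟩
  · intro Ψ hΨ hne
    have h := congrArg (Submodule.map (G.groundSpace d).subtype)
      (M.span_apply_eq_top (ψ := ⟨Ψ, hΨ⟩) fun h => hne (congrArg Subtype.val h))
    rw [Submodule.map_span, Submodule.map_top, Submodule.range_subtype] at h
    refine Eq.trans ?_ h
    congr 1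
    ext φ
    constructor
    · rintro ⟨τ', hτ', τ, hτ, rfl⟩
      refine ⟨_, ⟨G.dual.homologyClass d ⟨τ', hτ'⟩, G.homologyClass d ⟨τ, hτ⟩, rfl⟩, ?_⟩
      exact (F.weylModel_π'_apply _ _).trans (congrArg _ (F.weylModel_π_apply _ _))
    · rintro ⟨_, ⟨c', c, rfl⟩, rfl⟩
      obtain ⟨τ', rfl⟩ := Submodule.Quotient.mk_surjective _ c'
      obtain ⟨τ, rfl⟩ := Submodule.Quotient.mk_surjective _ c
      refine ⟨τ', τ'.2, τ, τ.2, ?_⟩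
      exact (F.weylModel_π'_apply _ _).trans (congrArg _ (F.weylModel_π_apply _ _))
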